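/- Let $k$ be an algebraically closed field. Let $Q_1$ be the quiver with vertices $b, mid, e$ and arrows $b\to e$, $b\to mid$, $mid\to e$, and let $Q_2$ be the quiver with vertices $b,-,+,e$ and arrows $b\to +$, $b\to -$, $+\to e$, $-\to e$ (no relations are imposed). For $i\in\{1,2\}$ let $Rep_k(Q_i)$ be the abelian category of finite-dimensional $k$-representations of $Q_i$. For $X,Y$ in $\mathcal A=Rep_k(Q_i)$ write $\mathrm{Hom}^p(X,Y)=\mathrm{Ext}^p_{\mathcal A}(X,Y)$ (zero for $p<0$), and write $\mathrm{Hom}^*(X,Y)=0$ if $\mathrm{Hom}^p(X,Y)=0$ for all $p$. An object $E$ is exceptional if $\mathrm{Hom}(E,E)=k$ and $\mathrm{Hom}^p(E,E)=0$ for all $p\neq 0$. A couple $\{\Gamma,\Gamma'\}$ of exceptional objects is Ext-nontrivial if $\mathrm{Ext}^1(\Gamma,\Gamma')\neq 0$ and $\mathrm{Ext}^1(\Gamma',\Gamma)\neq 0$. Then both categories $\mathcal A=Rep_k(Q_1)$ and $\mathcal A=Rep_k(Q_2)$ have the following properties. (a) RP property 1: for each Ext-nontrivial couple $\{\Gamma,\Gamma'\}\subset\mathcal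 A$ and each exceptional object $X\in\mathcal A$, if $\mathrm{Hom}^*(\Gamma,X)=0$, then $\mathrm{Hom}^*(X,\Gamma')=0$. RP property 2: for each Ext-nontrivial couple $\{\Gamma,\Gamma'\}\subset\mathcal A$ and any two exceptional objects $X,Y\in\mathcal A$, if $\mathrm{Hom}(\Gamma,X)\neq 0$, $\mathrm{Hom}(X,Y)\neq 0$ and $\mathrm{Hom}^*(\Gamma,Y)=0$, then $\mathrm{Hom}(\Gamma',Y)\neq 0$. (In both properties either member of the couple may play the role of $\Gamma$.) (b) For any two exceptional objects $X,Y\in\mathcal A$, at most one of the spaces $\mathrm{Hom}^p(X,Y)$, $p\in\mathbb Z$, is nonzero. -/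

import Mathlib

open CategoryTheory

universe w v u

/-- The category of finite-dimensional `k`-representations of a quiver `Q`: a representation
assigns a finite-dimensional `k`-vector space to every vertex and a linear map to every arrow,
i.e. it is a functor from the free category (path category) on `Q` to finite-dimensional
`k`-vector spaces; morphisms are natural transformations. -/
abbrev QuiverRep (k : Type u) [Field k] (Q : Type) [Quiver.{0} Q] : Type (u + 1) :=
  Paths Q ⥤ FGModuleCat.{u} k

/-- Ext-groups (`Hom` spaces between shifts of objects in the derived category) exist in the
category of representations, in a large enough universe. -/
instance QuiverRep.hasExt (k : Type u) [Field k] (Q : Type) [Quiver.{0} Q] :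
    HasExt.{u + 1} (QuiverRep k Q) :=
  HasExt.standard (QuiverRep k Q)

/-- Vertices of the quiver `Q₁`. -/
inductive Q1 : Type
  | b
  | mid
  | e

/-- Arrows of `Q₁`: `b ⟶ e`, `b ⟶ mid`, `mid ⟶ e`. -/
inductive Q1.Arrow : Q1 → Q1 → Type
  | be : Q1.Arrow Q1.b Q1.e
  | bmid : Q1.Arrow Q1.b Q1.mid
  | mide : Q1.Arrow Q1.mid Q1.e

instance Q1.quiver : Quiver.{0} Q1 := ⟨Q1.Arrow⟩

/-- Vertices of the quiver `Q₂`. -/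
inductive Q2 : Type
  | b
  | minus
  | plus
  | e

/-- Arrows of `Q₂`: `b ⟶ plus`, `b ⟶ minus`, `plus ⟶ e`, `minus ⟶ e` (with no relation). -/
inductive Q2.Arrow : Q2 → Q2 → Type
  | bplus : Q2.Arrow Q2.b Q2.plus
  | bminus : Q2.Arrow Q2.b Q2.minus
  | pluse : Q2.Arrow Q2.plus Q2.e
  | minuse : Q2.Arrow Q2.minus Q2.e

instance Q2.quiver : Quiver.{0} Q2 := ⟨Q2.Arrow⟩

section Exceptional

variable {A : Type u} [Category.{v} A] [Abelian A] [HasExt.{w} A]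

/-- `hom^*(X, Y) = 0`: the spaces `Ext^p(X, Y)` vanish in all degrees. -/
def HomStarVanishes (X Y : A) : Prop :=
  ∀ p : ℕ, Subsingleton (Abelian.Ext.{w} X Y p)

/-- At most one of the spaces `Ext^p(X, Y)` is nonzero. The degrees `p < 0` need not be mentioned:
between objects of the abelian category, `Hom(X, Y[p]) = 0` for `p < 0`. -/
def AtMostOneNonzeroDegree (X Y : A) : Prop :=
  ∀ p q : ℕ, Nontrivial (Abelian.Ext.{w} X Y p) → Nontrivial (Abelian.Ext.{w} X Y q) → p = q

variable (k : Type*) [Field k] [Linear k A]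

/-- `E` is exceptional: `Hom(E, E)` is one-dimensional over `k` (so equal to `k · id`), and
`Ext^p(E, E) = 0` for all `p ≥ 1`. -/
structure IsExceptional (E : A) : Prop where
  finrank_end : Module.finrank k (E ⟶ E) = 1
  ext_self : ∀ p : ℕ, 1 ≤ p → Subsingleton (Abelian.Ext.{w} E E p)

/-- `{L, Γ}` is an Ext-nontrivial couple of exceptional objects. -/
structure IsExtNontrivialCouple (L Γ : A) : Prop where
  left : IsExceptional.{w} k L
  right : IsExceptional.{w} k Γ
  ext_left_right : Nontrivial (Abelian.Ext.{w} L Γ 1)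
  ext_right_left : Nontrivial (Abelian.Ext.{w} Γ L 1)

variable (A)

/-- RP property 1. -/
def RPProperty1 : Prop :=
  ∀ Γ Γ' : A, IsExtNontrivialCouple.{w} k Γ Γ' →
    ∀ X : A, IsExceptional.{w} k X →
      HomStarVanishes.{w} Γ X → HomStarVanishes.{w} X Γ'

/-- RP property 2. -/
def RPProperty2 : Prop :=
  ∀ Γ Γ' : A, IsExtNontrivialCouple.{w} k Γ Γ' →
    ∀ X Y : A, IsExceptional.{w} k X → IsExceptional.{w} k Y →
      Nontrivial (Γ ⟶ X) → Nontrivial (X ⟶ Y) → HomStarVanishes.{w} Γ Y →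
        Nontrivial (Γ' ⟶ Y)

end Exceptional

/-! A representation of Q₁ is a representation of the square quiver b ⟶ s σ ⟶ e in which the arrow b
⟶ s false is an identity, so both quivers are handled inside `SqRep`. There Hom and Ext¹ are the
kernel and cokernel of one linear map `D`, so dim Hom − dim Ext¹ is the Euler form χ. Higher Ext
vanishes because representations of these quivers form a hereditary category.

For exceptional X, the vanishing of Ext¹(X, X) forces every arrow to have maximal rank, and χ(X, X)
= 1 says that the squares of the four dimension jumps along the arrows add up to 2. Hence dim e −
dim b is 1 (type P, all arrows injective), −1 (type I, all arrows surjective) or 0 (type R); see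
`Exc.type`. For type P the two path maps b ⟶ e span a pencil of injective maps. An eigenvalue
argument then shows that a nonzero subrepresentation is strictly larger at e than at b; type I is
dual. Counting dimensions, nonzero maps are mono within P and epi within I, and there are none from
R to P, from I to P or from I to R.

The exceptional objects of type R are only S σ, the simple at s σ, and N σ, with dimension 1 at the
three other vertices. By duality, Ext¹(X, Y) ≠ 0 yields a nonzero map Y ⟶ X whenever the arrows of X
are injective or those of Y surjective. With the vanishing of Hom between types this gives (b)
(`Exc.homZ_or_extZ`) and shows that an Ext-nontrivial couple is some {S σ, N σ} (`Exc.couple`).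

Finally Hom(S σ, X) is the kernel of s σ ⟶ e and Hom(N σ, X) is the kernel of b ⟶ s σ. RP property 1
reduces to one of these arrows being bijective. RP property 2 reduces to epimorphisms within R and
to χ(S σ, Y) + χ(N σ, Y) = dim b − dim e. -/

/-! ### Linear algebra: trace duality and pencils of linear maps -/

section LinearAlgebra

open Module

variable {k V W : Type*} [Field k] [AddCommGroup V] [Module k V] [AddCommGroup W] [Module k W]

theorem LinearMap.exists_apply_eq_of_ne_zero {v : V} (hv : v ≠ 0) (w : W) :
    ∃ f : V →ₗ[k] W, f v = w := by
  obtain ⟨ξ, hξ⟩ := Projective.exists_dual_eq_one k hv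
  exact ⟨ξ.smulRight w, by simp [hξ]⟩

theorem LinearMap.exists_leftInverse_apply {f : V →ₗ[k] W} (hf : Function.Injective f) :
    ∃ g : W →ₗ[k] V, ∀ x, g (f x) = x := by
  obtain ⟨g, hg⟩ := f.exists_leftInverse_of_injective (LinearMap.ker_eq_bot.2 hf)
  exact ⟨g, fun x => LinearMap.congr_fun hg x⟩

theorem LinearMap.exists_rightInverse_apply {f : V →ₗ[k] W} (hf : Function.Surjective f) :
    ∃ g : W →ₗ[k] V, ∀ x, f (g x) = x := by
  obtain ⟨g, hg⟩ := f.exists_rightInverse_of_surjective (LinearMap.range_eq_top.2 hf)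
  exact ⟨g, fun x => LinearMap.congr_fun hg x⟩

/-- A functional on `Hom(V, W)` is given on maps of rank one by a map `W → V`. -/
theorem LinearMap.exists_dual_smulRight [FiniteDimensional k V]
    (Ψ : (V →ₗ[k] W) →ₗ[k] k) :
    ∃ ψ : W →ₗ[k] V, (∀ (ξ : V →ₗ[k] k) (w : W), Ψ (ξ.smulRight w) = ξ (ψ w)) ∧
      (ψ = 0 → Ψ = 0) := by
  let χ : W →ₗ[k] Dual k (Dual k V) :=
    LinearMap.mk₂ k (fun w ξ => Ψ (ξ.smulRight w))
      (fun w w' ξ => by rw [← map_add]; congr 1; ext; simp)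
      (fun c w ξ => by rw [← map_smul]; congr 1; ext; exact smul_comm _ c w)
      (fun w ξ ξ' => by rw [← map_add]; congr 1; ext; simp [add_smul])
      (fun c w ξ => by rw [← map_smul]; congr 1; ext; simp [mul_smul])
  have key : ∀ (ξ : V →ₗ[k] k) (w : W), Ψ (ξ.smulRight w) =
      ξ (((evalEquiv k V).symm.toLinearMap ∘ₗ χ) w) := fun ξ w => by
    have : ξ ((evalEquiv k V).symm (χ w)) = χ w ξ := by
      rw [Module.apply_evalEquiv_symm_apply]
    exact this.symm
  refine ⟨_, key, fun h => LinearMap.ext fun φ => ?_⟩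
  have b := finBasis k V
  have : φ = ∑ i, (b.coord i).smulRight (φ (b i)) := by
    refine b.ext fun j => ?_
    rw [LinearMap.sum_apply, Finset.sum_eq_single j]
    · simp
    · intro i _ hij
      simp [Finsupp.single_eq_of_ne hij]
    · simp
  rw [this, map_sum]
  simp only [key, h]
  simp

/-- If no member of the pencil spanned by `F` and `G` has a kernel, then a nonzero subspace `U` has
smaller dimension than any subspace containing `F U` and `G U`. -/
theorem finrank_lt_of_pencil_injective [IsAlgClosed k] [FiniteDimensional k V]
    [FiniteDimensional k W] {F G : V →ₗ[k] W} (hF : Function.Injective F)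
    (hG : ∀ c : k, Function.Injective (G - c • F)) {U : Submodule k V} {U' : Submodule k W}
    (hFU : ∀ x ∈ U, F x ∈ U') (hGU : ∀ x ∈ U, G x ∈ U') (hU : U ≠ ⊥) :
    finrank k U < finrank k U' := by
  let F' := F.restrict hFU
  let G' := G.restrict hGU
  have hF' : Function.Injective F' := fun x y h => Subtype.ext (hF (congrArg Subtype.val h))
  by_contra hlt
  have heq : finrank k U = finrank k U' :=
    le_antisymm (LinearMap.finrank_le_finrank_of_injective hF') (not_lt.1 hlt)
  let Φ := LinearEquiv.ofInjectiveOfFinrankEq F' hF' heq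
  have := Submodule.nontrivial_iff_ne_bot.2 hU
  -- If the dimensions agree, `F` restricts to an isomorphism of `U` onto `U'`, and an eigenvector
  -- of F⁻¹G for `c` lies in the kernel of `G - c • F`.
  obtain ⟨c, hc⟩ := End.exists_eigenvalue (Φ.symm.toLinearMap ∘ₗ G')
  obtain ⟨x, hx⟩ := hc.exists_hasEigenvector
  have h1 : Φ.symm (G' x) = c • x := hx.apply_eq_smul
  rw [LinearEquiv.symm_apply_eq, map_smul] at h1
  have h2 : G x = c • F x := congrArg Subtype.val h1
  have h3 : (x : V) = 0 := hG c (by simp [h2])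
  exact hx.2 (Subtype.ext h3)

theorem LinearMap.dualMap_mem_dualAnnihilator {F : V →ₗ[k] W} {U : Submodule k V}
    {U' : Submodule k W} (hFU : ∀ x ∈ U, F x ∈ U') :
    ∀ ξ ∈ U'.dualAnnihilator, F.dualMap ξ ∈ U.dualAnnihilator := fun ξ hξ => by
  rw [Submodule.mem_dualAnnihilator] at hξ ⊢
  exact fun x hx => hξ _ (hFU x hx)

theorem finrank_lt_of_pencil_surjective [IsAlgClosed k] [FiniteDimensional k V]
    [FiniteDimensional k W] {F G : V →ₗ[k] W} (hF : Function.Surjective F)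
    (hG : ∀ c : k, Function.Surjective (G - c • F)) {U : Submodule k V} {U' : Submodule k W}
    (hFU : ∀ x ∈ U, F x ∈ U') (hGU : ∀ x ∈ U, G x ∈ U') (hU : U' ≠ ⊤) :
    finrank k W + finrank k U < finrank k V + finrank k U' := by
  have h := finrank_lt_of_pencil_injective (F := F.dualMap) (G := G.dualMap)
    (LinearMap.dualMap_injective_iff.2 hF)
    (fun c => by
      have := LinearMap.dualMap_injective_iff.2 (hG c)
      convert this using 2
      ext
      simp)
    (LinearMap.dualMap_mem_dualAnnihilator hFU) (LinearMap.dualMap_mem_dualAnnihilator hGU)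
    (fun h => hU (Subspace.dualAnnihilator_inj.1 (h.trans Submodule.dualAnnihilator_top.symm)))
  have h1 := Subspace.finrank_add_finrank_dualAnnihilator_eq U
  have h2 := Subspace.finrank_add_finrank_dualAnnihilator_eq U'
  omega

end LinearAlgebra

/-- A finite-dimensional representation of the quiver `b ⟶ s σ ⟶ e`, where `σ` takes two values. -/
structure SqRep (k : Type u) [Field k] where
  b : FGModuleCat.{u} k
  s : Bool → FGModuleCat.{u} k
  e : FGModuleCat.{u} k
  i : ∀ σ, b →ₗ[k] s σ
  o : ∀ σ, s σ →ₗ[k] e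

/-! ### Representations of the square quiver: Euler form and types of exceptional objects -/

namespace SqRep

open Module LinearMap

variable {k : Type u} [Field k]

/-- Families of linear maps between the spaces at the vertices. -/
abbrev C0 (X Y : SqRep k) : Type u :=
  (X.b →ₗ[k] Y.b) × (∀ σ, X.s σ →ₗ[k] Y.s σ) × (X.e →ₗ[k] Y.e)

/-- Families of linear maps along the arrows. -/
abbrev C1 (X Y : SqRep k) : Type u :=
  (∀ σ, X.b →ₗ[k] Y.s σ) × (∀ σ, X.s σ →ₗ[k] Y.e)

/-- The two-term complex with cohomology `Hom(X, Y)` and `Ext¹(X, Y)`. -/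
def D (X Y : SqRep k) : C0 X Y →ₗ[k] C1 X Y where
  toFun f := (fun σ => f.2.1 σ ∘ₗ X.i σ - Y.i σ ∘ₗ f.1, fun σ => f.2.2 ∘ₗ X.o σ - Y.o σ ∘ₗ f.2.1 σ)
  map_add' f g := by
    ext <;> simp [sub_add_sub_comm]
  map_smul' c f := by
    ext <;> simp [smul_sub]

/-- `f` is a morphism of representations. -/
structure IsHom {X Y : SqRep k} (f : C0 X Y) : Prop where
  i : ∀ σ x, f.2.1 σ (X.i σ x) = Y.i σ (f.1 x)
  o : ∀ σ x, f.2.2 (X.o σ x) = Y.o σ (f.2.1 σ x)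

/-- There are no nonzero morphisms from `X` to `Y`. -/
def HomZ (X Y : SqRep k) : Prop := ∀ f : C0 X Y, IsHom f → f = 0

/-- The vanishing of `Ext¹(X, Y)`. -/
def ExtZ (X Y : SqRep k) : Prop := Function.Surjective (D X Y)

/-- The identity family. -/
abbrev one (X : SqRep k) : C0 X X := (LinearMap.id, fun _ => LinearMap.id, LinearMap.id)

/-- Exceptional representations. -/
structure Exc (X : SqRep k) : Prop where
  one_ne : one X ≠ 0
  scalar : ∀ f : C0 X X, IsHom f → ∃ c : k, f = c • one X
  ext : ExtZ X X

variable {X Y Z : SqRep k}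

theorem C0.eq_zero {f : C0 X Y} (hb : f.1 = 0) (hs : ∀ σ, f.2.1 σ = 0) (he : f.2.2 = 0) :
    f = 0 :=
  Prod.ext hb (Prod.ext (funext hs) he)

theorem isHom_iff (f : C0 X Y) : IsHom f ↔ D X Y f = 0 := by
  constructor
  · rintro ⟨hi, ho⟩
    ext <;> simp [D, hi, ho]
  · intro h
    exact ⟨fun σ x => sub_eq_zero.1 (LinearMap.congr_fun (congrFun (congrArg Prod.fst h) σ) x),
      fun σ x => sub_eq_zero.1 (LinearMap.congr_fun (congrFun (congrArg Prod.snd h) σ) x)⟩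

theorem extZ_iff : ExtZ X Y ↔ ∀ φ : C1 X Y, ∃ g : C0 X Y,
    (∀ σ x, g.2.1 σ (X.i σ x) - Y.i σ (g.1 x) = φ.1 σ x) ∧
    (∀ σ x, g.2.2 (X.o σ x) - Y.o σ (g.2.1 σ x) = φ.2 σ x) := by
  refine forall_congr' fun φ => exists_congr fun g => ?_
  constructor
  · rintro rfl
    exact ⟨fun _ _ => rfl, fun _ _ => rfl⟩
  · rintro ⟨h1, h2⟩
    exact Prod.ext (funext fun σ => LinearMap.ext (h1 σ)) (funext fun σ => LinearMap.ext (h2 σ))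

theorem not_homZ : ¬ HomZ X Y ↔ ∃ f : C0 X Y, IsHom f ∧ f ≠ 0 := by
  simp [HomZ]

/-- The Euler form. -/
noncomputable def euler (X Y : SqRep k) : ℤ :=
  finrank k X.b * finrank k Y.b + finrank k X.e * finrank k Y.e
    + ∑ σ, (finrank k (X.s σ) * finrank k (Y.s σ) : ℤ)
    - ∑ σ, (finrank k X.b * finrank k (Y.s σ) : ℤ) - ∑ σ, (finrank k (X.s σ) * finrank k Y.e : ℤ)

theorem finrank_sub_eq_euler (X Y : SqRep k) :
    (finrank k (C0 X Y) : ℤ) - finrank k (C1 X Y) = euler X Y := by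
  simp only [C0, C1, finrank_prod, finrank_pi_fintype, finrank_linearMap, euler]
  push_cast
  ring

theorem ExtZ.finrank_ker (h : ExtZ X Y) : (finrank k (D X Y).ker : ℤ) = euler X Y := by
  have h1 := (D X Y).finrank_range_add_finrank_ker
  rw [LinearMap.range_eq_top.2 h, finrank_top] at h1
  have := finrank_sub_eq_euler X Y
  omega

theorem HomZ.ker_eq (h : HomZ X Y) : (D X Y).ker = ⊥ :=
  (Submodule.eq_bot_iff _).2 fun f hf => h f ((isHom_iff f).2 hf)

theorem HomZ.euler_nonpos (h : HomZ X Y) : euler X Y ≤ 0 := by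
  have h1 := (D X Y).finrank_range_add_finrank_ker
  rw [h.ker_eq, finrank_bot] at h1
  have := (D X Y).range.finrank_le
  have := finrank_sub_eq_euler X Y
  omega

/-- `D X Y` is then an injective map between spaces of equal dimension. -/
theorem HomZ.extZ (h : HomZ X Y) (h0 : euler X Y = 0) : ExtZ X Y := by
  have := finrank_sub_eq_euler X Y
  exact (LinearMap.injective_iff_surjective_of_finrank_eq_finrank (by omega)).1
    (LinearMap.ker_eq_bot.1 h.ker_eq)

theorem HomZ.euler_eq_zero (h : HomZ X Y) (h' : ExtZ X Y) : euler X Y = 0 := by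
  rw [← h'.finrank_ker, h.ker_eq, finrank_bot]
  rfl

theorem isHom_one (X : SqRep k) : IsHom (one X) := ⟨fun _ _ => rfl, fun _ _ => rfl⟩

theorem Exc.euler_self (h : Exc X) : euler X X = 1 := by
  rw [← h.ext.finrank_ker]
  have h1 : one X ∈ (D X X).ker := (isHom_iff _).1 (isHom_one X)
  have : finrank k (D X X).ker = 1 := by
    refine finrank_eq_one (⟨one X, h1⟩ : (D X X).ker) (fun h0 => h.one_ne ?_) fun f => ?_
    · exact congrArg Subtype.val h0
    · obtain ⟨c, hc⟩ := h.scalar f ((isHom_iff _).2 f.2)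
      exact ⟨c, Subtype.ext hc.symm⟩
  omega

/-- The arrows of `X` are injective. -/
structure AllInj (X : SqRep k) : Prop where
  i : ∀ σ, Function.Injective (X.i σ)
  o : ∀ σ, Function.Injective (X.o σ)

/-- The arrows of `X` are surjective. -/
structure AllSurj (X : SqRep k) : Prop where
  i : ∀ σ, Function.Surjective (X.i σ)
  o : ∀ σ, Function.Surjective (X.o σ)

/-- If `v` is in the kernel and `w` outside the range, a cochain supported on this arrow and sending
`v` to `w` is not a coboundary: on `v` a coboundary takes values in the range. -/
theorem Exc.i_injective_or_surjective (h : Exc X) (σ : Bool) :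
    Function.Injective (X.i σ) ∨ Function.Surjective (X.i σ) := by
  by_contra! ⟨h1, h2⟩
  obtain ⟨v, hv, hv0⟩ : ∃ v, X.i σ v = 0 ∧ v ≠ 0 := by
    by_contra! h; exact h1 ((injective_iff_map_eq_zero _).2 h)
  obtain ⟨w, hw⟩ := not_forall.1 h2
  obtain ⟨f, hf⟩ := LinearMap.exists_apply_eq_of_ne_zero (k := k) hv0 w
  obtain ⟨g, hg, -⟩ := extZ_iff.1 h.ext (Function.update 0 σ f, 0)
  have := hg σ v
  simp only [Function.update_self, hf, hv, map_zero, zero_sub] at this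
  exact hw ⟨-g.1 v, by rw [map_neg, this]⟩

theorem Exc.o_injective_or_surjective (h : Exc X) (σ : Bool) :
    Function.Injective (X.o σ) ∨ Function.Surjective (X.o σ) := by
  by_contra! ⟨h1, h2⟩
  obtain ⟨v, hv, hv0⟩ : ∃ v, X.o σ v = 0 ∧ v ≠ 0 := by
    by_contra! h; exact h1 ((injective_iff_map_eq_zero _).2 h)
  obtain ⟨w, hw⟩ := not_forall.1 h2
  obtain ⟨f, hf⟩ := LinearMap.exists_apply_eq_of_ne_zero (k := k) hv0 w
  obtain ⟨g, -, hg⟩ := extZ_iff.1 h.ext (0, Function.update 0 σ f)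
  have := hg σ v
  simp only [Function.update_self, hf, hv, map_zero, zero_sub] at this
  exact hw ⟨-g.2.1 σ v, by rw [map_neg, this]⟩

/-- Preprojective type. -/
structure IsP (X : SqRep k) : Prop extends AllInj X where
  exc : Exc X
  finrank_e : finrank k X.e = finrank k X.b + 1

/-- Preinjective type. -/
structure IsI (X : SqRep k) : Prop extends AllSurj X where
  exc : Exc X
  finrank_b : finrank k X.b = finrank k X.e + 1

/-- Defect zero. -/
structure IsR (X : SqRep k) : Prop where
  exc : Exc X
  finrank_e : finrank k X.e = finrank k X.b

theorem injective_of_or {V W : FGModuleCat.{u} k} {f : V →ₗ[k] W}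
    (h : Function.Injective f ∨ Function.Surjective f) (hd : finrank k V ≤ finrank k W) :
    Function.Injective f :=
  h.elim id fun hs => (LinearMap.injective_iff_surjective_of_finrank_eq_finrank
    (hd.antisymm (LinearMap.finrank_le_finrank_of_surjective hs))).2 hs

theorem surjective_of_or {V W : FGModuleCat.{u} k} {f : V →ₗ[k] W}
    (h : Function.Injective f ∨ Function.Surjective f) (hd : finrank k W ≤ finrank k V) :
    Function.Surjective f :=
  h.elim (fun hs => (LinearMap.injective_iff_surjective_of_finrank_eq_finrank
    ((LinearMap.finrank_le_finrank_of_injective hs).antisymm hd)).1 hs) id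

/-- Twice the quadratic form of `euler` is this sum of squares. -/
theorem Exc.sum_sq (h : Exc X) :
    ∑ σ, (((finrank k X.b : ℤ) - finrank k (X.s σ)) ^ 2
      + ((finrank k (X.s σ) : ℤ) - finrank k X.e) ^ 2) = 2 := by
  have := h.euler_self
  simp only [euler, Fintype.sum_bool] at this ⊢
  linarith

theorem abs_le_one_of_sq_le {p : ℤ} (h : p ^ 2 ≤ 2) : -1 ≤ p ∧ p ≤ 1 := by
  constructor <;> nlinarith

theorem Exc.type (h : Exc X) : IsP X ∨ IsI X ∨ IsR X := by
  have hs := h.sum_sq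
  have hi := h.i_injective_or_surjective
  have ho := h.o_injective_or_surjective
  rw [Fintype.sum_bool] at hs
  -- The jumps are all in {−1, 0, 1} and exactly two are nonzero. As both paths have the same total
  -- jump, these two lie on different paths with equal sign, or on one path with opposite signs.
  have key : ∀ p q r s : ℤ, p ^ 2 + q ^ 2 + (r ^ 2 + s ^ 2) = 2 → p + q = r + s →
      (p + q = -1 ∧ p ≤ 0 ∧ q ≤ 0 ∧ r ≤ 0 ∧ s ≤ 0) ∨ (p + q = 1 ∧ 0 ≤ p ∧ 0 ≤ q ∧ 0 ≤ r ∧ 0 ≤ s) ∨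
      p + q = 0 := by
    intro p q r s h1 h2
    obtain ⟨p1, p2⟩ := abs_le_one_of_sq_le (p := p) (by nlinarith [sq_nonneg q, sq_nonneg r, sq_nonneg s])
    obtain ⟨q1, q2⟩ := abs_le_one_of_sq_le (p := q) (by nlinarith [sq_nonneg p, sq_nonneg r, sq_nonneg s])
    obtain ⟨r1, r2⟩ := abs_le_one_of_sq_le (p := r) (by nlinarith [sq_nonneg q, sq_nonneg p, sq_nonneg s])
    obtain ⟨s1, s2⟩ := abs_le_one_of_sq_le (p := s) (by nlinarith [sq_nonneg q, sq_nonneg r, sq_nonneg p])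
    interval_cases p <;> interval_cases q <;> interval_cases r <;> interval_cases s <;> omega
  rcases key _ _ _ _ hs (by ring) with ⟨h0, h1, h2, h3, h4⟩ | ⟨h0, h1, h2, h3, h4⟩ | h0
  · left
    have hd : ∀ σ, finrank k X.b ≤ finrank k (X.s σ) ∧ finrank k (X.s σ) ≤ finrank k X.e := by
      rw [Bool.forall_bool]; omega
    exact ⟨⟨fun σ => injective_of_or (hi σ) (hd σ).1, fun σ => injective_of_or (ho σ) (hd σ).2⟩,
      h, by omega⟩
  · right; left
    have hd : ∀ σ, finrank k (X.s σ) ≤ finrank k X.b ∧ finrank k X.e ≤ finrank k (X.s σ) := by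
      rw [Bool.forall_bool]; omega
    exact ⟨⟨fun σ => surjective_of_or (hi σ) (hd σ).1, fun σ => surjective_of_or (ho σ) (hd σ).2⟩,
      h, by omega⟩
  · right; right
    exact ⟨h, by omega⟩

/-- The composite along the path through `s σ`. -/
def path (X : SqRep k) (σ : Bool) : X.b →ₗ[k] X.e := X.o σ ∘ₗ X.i σ

theorem IsHom.path {f : C0 X Y} (hf : IsHom f) (σ : Bool) (x : X.b) :
    f.2.2 (X.path σ x) = Y.path σ (f.1 x) := by
  simp [SqRep.path, hf.o, hf.i]

theorem path_add_eq {g : C0 X X} {φ : C1 X X} {σ : Bool}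
    (h1 : ∀ x, g.2.1 σ (X.i σ x) - X.i σ (g.1 x) = φ.1 σ x)
    (h2 : ∀ x, g.2.2 (X.o σ x) - X.o σ (g.2.1 σ x) = φ.2 σ x) (x : X.b) :
    X.path σ (g.1 x) + φ.2 σ (X.i σ x) + X.o σ (φ.1 σ x) = g.2.2 (X.path σ x) := by
  simp only [SqRep.path, LinearMap.comp_apply, ← h1, ← h2, map_sub]
  abel

theorem IsP.path_injective (h : IsP X) (σ : Bool) : Function.Injective (X.path σ) :=
  (h.o σ).comp (h.i σ)

theorem IsI.path_surjective (h : IsI X) (σ : Bool) : Function.Surjective (X.path σ) :=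
  (h.o σ).comp (h.i σ)

/-- For `c ≠ 0`, suppose `v` is in the kernel and `w` is outside the range. Writing a cochain on the
arrow s false ⟶ e as a coboundary and comparing the two paths at `v` exhibits `w` in the range; the
factor `c⁻¹` cancels the coefficient of the second path. -/
theorem IsP.pencil_injective (h : IsP X) (c : k) :
    Function.Injective (X.path true - c • X.path false) := by
  by_cases hc : c = 0
  · simpa [hc] using h.path_injective true
  have hns : ¬ Function.Surjective (X.path true - c • X.path false) := fun hs => by
    have := LinearMap.finrank_le_finrank_of_surjective hs
    have := h.finrank_e
    omega
  rw [injective_iff_map_eq_zero]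
  by_contra! ⟨v, hv, hv0⟩
  obtain ⟨w, hw⟩ := not_forall.1 hns
  obtain ⟨f, hf⟩ := LinearMap.exists_apply_eq_of_ne_zero (k := k)
    (v := X.i false v) (fun h0 => hv0 (h.i false (by rw [h0, map_zero]))) (c⁻¹ • w)
  obtain ⟨g, hg1, hg2⟩ := extZ_iff.1 h.exc.ext (0, Function.update 0 false f)
  have ht := path_add_eq (hg1 true) (hg2 true) v
  have hf' := path_add_eq (hg1 false) (hg2 false) v
  have hv' : X.path true v = c • X.path false v := sub_eq_zero.1 hv
  refine hw ⟨g.1 v, ?_⟩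
  simp [hf, hv'] at ht hf' ⊢
  rw [ht, ← hf']
  simp [smul_smul, mul_inv_cancel₀ hc]

theorem IsI.pencil_surjective (h : IsI X) (c : k) :
    Function.Surjective (X.path true - c • X.path false) := by
  by_cases hc : c = 0
  · simpa [hc] using h.path_surjective true
  have hni : ¬ Function.Injective (X.path true - c • X.path false) := fun hs => by
    have := LinearMap.finrank_le_finrank_of_injective hs
    have := h.finrank_b
    omega
  rw [injective_iff_map_eq_zero] at hni
  push Not at hni
  obtain ⟨v, hv, hv0⟩ := hni
  by_contra hns
  obtain ⟨w, hw⟩ := not_forall.1 hns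
  obtain ⟨w', hw'⟩ := h.o false (c⁻¹ • w)
  obtain ⟨f, hf⟩ := LinearMap.exists_apply_eq_of_ne_zero (k := k) hv0 w'
  obtain ⟨g, hg1, hg2⟩ := extZ_iff.1 h.exc.ext (Function.update 0 false f, 0)
  have ht := path_add_eq (hg1 true) (hg2 true) v
  have hf' := path_add_eq (hg1 false) (hg2 false) v
  have hv' : X.path true v = c • X.path false v := sub_eq_zero.1 hv
  refine hw ⟨g.1 v, ?_⟩
  simp [hf, hw', hv'] at ht hf' ⊢
  rw [ht, ← hf']
  simp [smul_smul, mul_inv_cancel₀ hc]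

end SqRep

/-! ### Morphisms of types P and I, and duality for Ext¹ -/

namespace SqRep

open Module LinearMap

variable {k : Type u} [Field k] {X Y Z : SqRep k}

/-- Injectivity at every vertex. -/
structure IsMono (f : C0 X Y) : Prop where
  b : Function.Injective f.1
  s : ∀ σ, Function.Injective (f.2.1 σ)
  e : Function.Injective f.2.2

/-- Surjectivity at every vertex. -/
structure IsEpi (f : C0 X Y) : Prop where
  b : Function.Surjective f.1
  s : ∀ σ, Function.Surjective (f.2.1 σ)
  e : Function.Surjective f.2.2

/-- Cochains on `X` extend to `Y` through vertexwise retractions, and a solution on `Y` restricts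
along `f`: Ext¹(−, Z) is right exact. -/
theorem IsMono.extZ {f : C0 X Y} (hm : IsMono f) (hf : IsHom f) (h : ExtZ Y Z) : ExtZ X Z := by
  rw [extZ_iff] at h ⊢
  intro φ
  obtain ⟨r, hr⟩ := LinearMap.exists_leftInverse_apply hm.b
  choose t ht using fun σ => LinearMap.exists_leftInverse_apply (hm.s σ)
  obtain ⟨g, h1, h2⟩ := h (fun σ => φ.1 σ ∘ₗ r, fun σ => φ.2 σ ∘ₗ t σ)
  refine ⟨(g.1 ∘ₗ f.1, fun σ => g.2.1 σ ∘ₗ f.2.1 σ, g.2.2 ∘ₗ f.2.2), fun σ x => ?_, fun σ x => ?_⟩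
  · simpa [hf.i, hr] using h1 σ (f.1 x)
  · simpa [hf.o, ht] using h2 σ (f.2.1 σ x)

theorem IsEpi.extZ {f : C0 X Y} (hm : IsEpi f) (hf : IsHom f) (h : ExtZ Z X) : ExtZ Z Y := by
  rw [extZ_iff] at h ⊢
  intro φ
  obtain ⟨r, hr⟩ := LinearMap.exists_rightInverse_apply hm.e
  choose t ht using fun σ => LinearMap.exists_rightInverse_apply (hm.s σ)
  obtain ⟨g, h1, h2⟩ := h (fun σ => t σ ∘ₗ φ.1 σ, fun σ => r ∘ₗ φ.2 σ)
  refine ⟨(f.1 ∘ₗ g.1, fun σ => f.2.1 σ ∘ₗ g.2.1 σ, f.2.2 ∘ₗ g.2.2), fun σ x => ?_, fun σ x => ?_⟩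
  · have := congrArg (f.2.1 σ) (h1 σ x)
    simpa [hf.i, ht] using this
  · have := congrArg f.2.2 (h2 σ x)
    simpa [hf.o, hr] using this

/-- Both path maps of `Y` carry the range at b into the range at e, so the pencil estimate applies.
If the range at b is zero, the range at e is still nonzero because the arrows into e are injective.
-/
theorem IsP.finrank_range_lt [IsAlgClosed k] (hY : IsP Y) {f : C0 X Y} (hf : IsHom f)
    (h0 : f ≠ 0) : finrank k (range f.1) < finrank k (range f.2.2) := by
  by_cases hb : f.1 = 0
  · have he : f.2.2 ≠ 0 := fun he => h0 <| C0.eq_zero hb (fun σ => LinearMap.ext fun x => by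
      apply hY.o σ
      rw [← hf.o, he]
      simp) he
    rw [hb, range_zero, finrank_bot, pos_iff_ne_zero, Ne, Submodule.finrank_eq_zero]
    rwa [Ne, ← LinearMap.range_eq_bot] at he
  · refine finrank_lt_of_pencil_injective (hY.path_injective false) hY.pencil_injective ?_ ?_
      (fun h => hb (LinearMap.range_eq_bot.1 h)) <;>
    · rintro _ ⟨x, rfl⟩
      rw [← hf.path]
      exact ⟨_, rfl⟩

theorem IsP.finrank_ker_lt [IsAlgClosed k] (hX : IsP X) {f : C0 X Y} (hf : IsHom f)
    (h0 : ¬ IsMono f) : finrank k (ker f.1) < finrank k (ker f.2.2) := by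
  by_cases hb : ker f.1 = ⊥
  · have he : ker f.2.2 ≠ ⊥ := fun he => h0 ⟨LinearMap.ker_eq_bot.1 hb, fun σ =>
      (injective_iff_map_eq_zero _).2 fun x hx => by
        apply hX.o σ
        apply LinearMap.ker_eq_bot.1 he
        rw [hf.o, hx]
        simp, LinearMap.ker_eq_bot.1 he⟩
    rwa [hb, finrank_bot, pos_iff_ne_zero, Ne, Submodule.finrank_eq_zero]
  · refine finrank_lt_of_pencil_injective (hX.path_injective false) hX.pencil_injective ?_ ?_ hb <;>
    · intro x hx
      rw [mem_ker, hf.path, mem_ker.1 hx, map_zero]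

/-- In terms of the cokernel of `f`: its dimension at e is less than at b. -/
theorem IsI.finrank_range_lt [IsAlgClosed k] (hY : IsI Y) {f : C0 X Y} (hf : IsHom f)
    (h0 : ¬ IsEpi f) : finrank k Y.e + finrank k (range f.1) <
      finrank k Y.b + finrank k (range f.2.2) := by
  by_cases he : range f.2.2 = ⊤
  · have hb : range f.1 ≠ ⊤ := fun hb => h0 ⟨LinearMap.range_eq_top.1 hb, fun σ y => by
      obtain ⟨y, rfl⟩ := hY.i σ y
      obtain ⟨x, rfl⟩ := LinearMap.range_eq_top.1 hb y
      exact ⟨X.i σ x, hf.i σ x⟩, LinearMap.range_eq_top.1 he⟩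
    have := Submodule.finrank_lt hb
    rw [he, finrank_top]
    omega
  · refine finrank_lt_of_pencil_surjective (hY.path_surjective false) hY.pencil_surjective ?_ ?_
      he <;>
    · rintro _ ⟨x, rfl⟩
      rw [← hf.path]
      exact ⟨_, rfl⟩

theorem IsI.finrank_ker_lt [IsAlgClosed k] (hX : IsI X) {f : C0 X Y} (hf : IsHom f)
    (h0 : f ≠ 0) : finrank k X.e + finrank k (ker f.1) <
      finrank k X.b + finrank k (ker f.2.2) := by
  by_cases he : f.2.2 = 0
  · have hb : f.1 ≠ 0 := fun hb => h0 <| C0.eq_zero hb (fun σ => LinearMap.ext fun x => by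
      obtain ⟨x, rfl⟩ := hX.i σ x
      rw [hf.i, hb]
      simp) he
    have := Submodule.finrank_lt (fun h => hb (LinearMap.ker_eq_top.1 h))
    rw [he, ker_zero, finrank_top]
    omega
  · refine finrank_lt_of_pencil_surjective (hX.path_surjective false) hX.pencil_surjective ?_ ?_
      (fun h => he (LinearMap.ker_eq_top.1 h)) <;>
    · intro x hx
      rw [mem_ker, hf.path, mem_ker.1 hx, map_zero]

/-- A nonzero kernel and a nonzero range would each contribute at least 1 to dim e − dim b, which is
only 1. -/
theorem IsP.isMono [IsAlgClosed k] (hX : IsP X) (hY : IsP Y) {f : C0 X Y} (hf : IsHom f)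
    (h0 : f ≠ 0) : IsMono f := by
  by_contra hm
  have h1 := hX.finrank_ker_lt hf hm
  have h2 := hY.finrank_range_lt hf h0
  have h3 := f.1.finrank_range_add_finrank_ker
  have h4 := f.2.2.finrank_range_add_finrank_ker
  have := hX.finrank_e
  omega

theorem IsI.isEpi [IsAlgClosed k] (hX : IsI X) (hY : IsI Y) {f : C0 X Y} (hf : IsHom f)
    (h0 : f ≠ 0) : IsEpi f := by
  by_contra hm
  have h1 := hX.finrank_ker_lt hf h0
  have h2 := hY.finrank_range_lt hf hm
  have h3 := f.1.finrank_range_add_finrank_ker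
  have h4 := f.2.2.finrank_range_add_finrank_ker
  have := hX.finrank_b
  have := hY.finrank_b
  omega

/-- The range of `f` at e is then the image of its range at b under a path map, so it cannot be
larger. -/
theorem IsP.homZ_of_path_surjective [IsAlgClosed k] (hY : IsP Y) {σ : Bool}
    (hX : Function.Surjective (X.path σ)) : HomZ X Y := by
  intro f hf
  by_contra h0
  refine (hY.finrank_range_lt hf h0).not_ge ?_
  have : range f.2.2 = (range f.1).map (Y.path σ) := by
    rw [← range_comp, ← range_comp_of_range_eq_top f.2.2 (LinearMap.range_eq_top.2 hX)]
    congr 1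
    exact LinearMap.ext (hf.path σ)
  rw [this]
  exact Submodule.finrank_map_le _ _

theorem IsI.homZ_of_path_injective [IsAlgClosed k] (hX : IsI X) {σ : Bool}
    (hY : Function.Injective (Y.path σ)) : HomZ X Y := by
  intro f hf
  by_contra h0
  have h1 := hX.finrank_ker_lt hf h0
  have h3 := f.1.finrank_range_add_finrank_ker
  have h4 := f.2.2.finrank_range_add_finrank_ker
  have h5 : finrank k (range f.1) ≤ finrank k (range f.2.2) := by
    have h6 : (range f.1).map (Y.path σ) ≤ range f.2.2 := by
      rintro _ ⟨_, ⟨x, rfl⟩, rfl⟩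
      rw [← hf.path]
      exact ⟨_, rfl⟩
    rw [(Submodule.equivMapOfInjective _ hY _).finrank_eq]
    exact Submodule.finrank_mono h6
  omega

/-- A nonzero element of the dual of `Ext¹(X, Y)`, as maps backwards along the arrows. -/
theorem exists_dual_of_not_extZ (h : ¬ ExtZ X Y) :
    ∃ (p : ∀ σ, Y.s σ →ₗ[k] X.b) (q : ∀ σ, Y.e →ₗ[k] X.s σ),
      ((∃ σ, p σ ≠ 0) ∨ ∃ σ, q σ ≠ 0) ∧
      (∀ y, p true (Y.i true y) + p false (Y.i false y) = 0) ∧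
      (∀ σ y, X.i σ (p σ y) = q σ (Y.o σ y)) ∧
      (∀ y, X.o true (q true y) + X.o false (q false y) = 0) := by
  obtain ⟨Ψ, hΨ, hD⟩ := Submodule.exists_le_ker_of_lt_top (range (D X Y))
    (lt_top_iff_ne_top.2 fun h' => h (LinearMap.range_eq_top.1 h'))
  have hD' : ∀ g, Ψ (D X Y g) = 0 := fun g => hD ⟨g, rfl⟩
  obtain ⟨A, B, hsplit⟩ : ∃ (A : ∀ σ, (X.b →ₗ[k] Y.s σ) →ₗ[k] k)
      (B : ∀ σ, (X.s σ →ₗ[k] Y.e) →ₗ[k] k), ∀ φ : C1 X Y,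
      -- The functional splits over the four arrows, and the trace pairing turns each summand into a
      -- map backwards. Vanishing on coboundaries, tested at each vertex, gives the three relations.
      Ψ φ = A true (φ.1 true) + A false (φ.1 false) + B true (φ.2 true) + B false (φ.2 false) := by
    refine ⟨fun σ => Ψ ∘ₗ inl k _ _ ∘ₗ LinearMap.single k (fun σ => X.b →ₗ[k] Y.s σ) σ,
      fun σ => Ψ ∘ₗ inr k _ _ ∘ₗ LinearMap.single k (fun σ => X.s σ →ₗ[k] Y.e) σ, fun φ => ?_⟩
    simp only [LinearMap.comp_apply, ← map_add]
    congr 1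
    refine Prod.ext (funext fun σ => ?_) (funext fun σ => ?_) <;> cases σ <;> simp
  choose p hp hp0 using fun σ => LinearMap.exists_dual_smulRight (A σ)
  choose q hq hq0 using fun σ => LinearMap.exists_dual_smulRight (B σ)
  have ext_dual : ∀ {V : FGModuleCat.{u} k} {v w : V}, (∀ ξ : V →ₗ[k] k, ξ v = ξ w) → v = w :=
    fun h => (Module.forall_dual_apply_eq_zero_iff k _).1 (fun ξ => by rw [map_sub, h, sub_self])
      |> sub_eq_zero.1
  refine ⟨p, q, ?_, fun y => ext_dual fun ξ => ?_, fun σ y => ext_dual fun ξ => ?_,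
    fun y => ext_dual fun ξ => ?_⟩
  · by_contra! ⟨hp', hq'⟩
    refine hΨ (LinearMap.ext fun φ => ?_)
    rw [hsplit]
    simp [hp0 _ (hp' _), hq0 _ (hq' _)]
  · have h := hD' (ξ.smulRight y, 0, 0)
    have h1 : ∀ σ, Y.i σ ∘ₗ ξ.smulRight y = ξ.smulRight (Y.i σ y) := fun σ => by ext; simp
    rw [hsplit] at h
    simp [D, h1, hp] at h
    rw [map_add, map_zero]
    linear_combination -h
  · have h := hD' (0, Pi.single σ (ξ.smulRight y), 0)
    have h1 : ξ.smulRight y ∘ₗ X.i σ = (ξ ∘ₗ X.i σ).smulRight y := by ext; simp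
    have h2 : Y.o σ ∘ₗ ξ.smulRight y = ξ.smulRight (Y.o σ y) := by ext; simp
    rw [hsplit] at h
    cases σ <;> simp [D, h1, h2, hp, hq] at h <;> linear_combination h
  · have h := hD' (0, 0, ξ.smulRight y)
    have h1 : ∀ σ, ξ.smulRight y ∘ₗ X.o σ = (ξ ∘ₗ X.o σ).smulRight y := fun σ => by ext; simp
    rw [hsplit] at h
    simp [D, h1, hq] at h
    rw [map_add, map_zero]
    linear_combination h

theorem exists_hom_of_not_extZ (h : ¬ ExtZ X Y) :
    ∃ (p : ∀ σ, Y.s σ →ₗ[k] X.b) (q : ∀ σ, Y.e →ₗ[k] X.s σ) (f : C0 Y X),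
      ((∃ σ, p σ ≠ 0) ∨ ∃ σ, q σ ≠ 0) ∧ IsHom f ∧
      (f = 0 → ∀ σ, (∀ y, X.i σ (p σ y) = 0) ∧ (∀ y, q σ (Y.o σ y) = 0) ∧
        (∀ y, p σ (Y.i σ y) = 0) ∧ ∀ y, X.o σ (q σ y) = 0) := by
  obtain ⟨p, q, h0, h1, h2, h3⟩ := exists_dual_of_not_extZ h
  -- The relations at b and e make the composites through the two middle vertices differ by a sign,
  -- hence the sign at s false.
  let f : C0 Y X := (p true ∘ₗ Y.i true, fun σ => if σ then X.i σ ∘ₗ p σ else -(X.i σ ∘ₗ p σ),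
    X.o true ∘ₗ q true)
  refine ⟨p, q, f, h0, ⟨fun σ x => ?_, fun σ x => ?_⟩, fun hf => ?_⟩
  · cases σ
    · simp [f, eq_neg_of_add_eq_zero_left (h1 x)]
    · simp [f]
  · cases σ
    · simp [f, eq_neg_of_add_eq_zero_left (h3 _), h2]
    · simp [f, h2]
  · have hb : ∀ y, p true (Y.i true y) = 0 := LinearMap.congr_fun (congrArg Prod.fst hf)
    have he : ∀ y, X.o true (q true y) = 0 :=
      LinearMap.congr_fun (congrArg (fun g : C0 Y X => g.2.2) hf)
    have hs : ∀ σ y, X.i σ (p σ y) = 0 := fun σ y => by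
      have := LinearMap.congr_fun (congrArg (fun g : C0 Y X => g.2.1 σ) hf) y
      cases σ <;> simpa [f] using this
    have hb' : ∀ y, p false (Y.i false y) = 0 := fun y => by simpa [hb] using h1 y
    have he' : ∀ y, X.o false (q false y) = 0 := fun y => by simpa [he] using h3 y
    intro σ
    refine ⟨hs σ, fun y => by rw [← h2, hs], ?_, ?_⟩ <;> cases σ <;> assumption

/-- If the induced map Y ⟶ X were zero, composing `p` and `q` with the injective arrows of `X` would
give zero, so the dual class itself would be zero. -/
theorem AllInj.not_homZ (hX : AllInj X) (h : ¬ ExtZ X Y) : ¬ HomZ Y X := by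
  obtain ⟨p, q, f, h0, hf, hf0⟩ := exists_hom_of_not_extZ h
  intro hz
  have := hf0 (hz f hf)
  rcases h0 with ⟨σ, h0⟩ | ⟨σ, h0⟩
  · exact h0 (LinearMap.ext fun y => hX.i σ (by simp [(this σ).1]))
  · exact h0 (LinearMap.ext fun y => hX.o σ (by simp [(this σ).2.2.2]))

theorem AllSurj.not_homZ (hY : AllSurj Y) (h : ¬ ExtZ X Y) : ¬ HomZ Y X := by
  obtain ⟨p, q, f, h0, hf, hf0⟩ := exists_hom_of_not_extZ h
  intro hz
  have := hf0 (hz f hf)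
  rcases h0 with ⟨σ, h0⟩ | ⟨σ, h0⟩
  · refine h0 (LinearMap.ext fun y => ?_)
    obtain ⟨y, rfl⟩ := hY.i σ y
    exact (this σ).2.2.1 y
  · refine h0 (LinearMap.ext fun y => ?_)
    obtain ⟨y, rfl⟩ := hY.o σ y
    exact (this σ).2.1 y

end SqRep

/-! ### Exceptional representations of defect zero -/

namespace SqRep

open Module LinearMap

variable {k : Type u} [Field k] {X Y Z : SqRep k}

theorem eq_zero_of_finrank {V : FGModuleCat.{u} k} (h : finrank k V = 0) (x : V) : x = 0 :=
  have := Module.finrank_zero_iff.1 h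
  Subsingleton.elim _ _

theorem ext_of_finrank_left {V W : FGModuleCat.{u} k} (h : finrank k V = 0) (f : V →ₗ[k] W) :
    f = 0 :=
  LinearMap.ext fun x => by rw [eq_zero_of_finrank h x, map_zero, map_zero]

theorem ext_of_finrank_right {V W : FGModuleCat.{u} k} (h : finrank k W = 0) (f : V →ₗ[k] W) :
    f = 0 :=
  LinearMap.ext fun _ => eq_zero_of_finrank h _

theorem bool_cases (σ ρ : Bool) : ρ = σ ∨ ρ = !σ := by
  cases σ <;> cases ρ <;> simp

theorem sum_bool_eq {M : Type*} [AddCommMonoid M] (a : Bool → M) (σ : Bool) :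
    ∑ ρ, a ρ = a σ + a (!σ) := by
  cases σ <;> simp [add_comm]

theorem euler_eq (X Y : SqRep k) (σ : Bool) : euler X Y =
    finrank k X.b * finrank k Y.b + finrank k X.e * finrank k Y.e
    + (finrank k (X.s σ) * finrank k (Y.s σ) + finrank k (X.s !σ) * finrank k (Y.s !σ))
    - (finrank k X.b * finrank k (Y.s σ) + finrank k X.b * finrank k (Y.s !σ))
    - (finrank k (X.s σ) * finrank k Y.e + finrank k (X.s !σ) * finrank k Y.e) := by
  simp only [euler, sum_bool_eq _ σ]

/-- The simple representation at `s σ` (by its dimension vector). -/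
structure IsS (σ : Bool) (X : SqRep k) : Prop where
  b : finrank k X.b = 0
  e : finrank k X.e = 0
  s : finrank k (X.s σ) = 1
  s' : finrank k (X.s !σ) = 0

/-- The representation with dimension vector complementary to the simple one at `s σ`, and
isomorphisms along the other path. -/
structure IsN (σ : Bool) (X : SqRep k) : Prop where
  b : finrank k X.b = 1
  e : finrank k X.e = 1
  s : finrank k (X.s σ) = 0
  s' : finrank k (X.s !σ) = 1
  i : Function.Bijective (X.i !σ)
  o : Function.Bijective (X.o !σ)

theorem IsN.path {σ : Bool} (h : IsN σ X) : Function.Bijective (X.path !σ) := h.o.comp h.i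

/-- Travelling once around the square, with the bijective path inverted, defines an endomorphism,
hence a scalar. A nonzero scalar would make `X.i σ` bijective, against the dimensions. -/
theorem Exc.path_eq_zero (h : Exc X) {σ : Bool} (hi : Function.Bijective (X.i !σ))
    (ho : Function.Bijective (X.o !σ)) (hs : finrank k X.b ≠ finrank k (X.s σ)) (x : X.b) :
    X.path σ x = 0 := by
  let F := LinearEquiv.ofBijective (X.path !σ) (ho.comp hi)
  have hF : ∀ x, X.o (!σ) (X.i (!σ) x) = F x := fun _ => rfl
  have hi' : ∀ y, X.i (!σ) (F.symm (X.o (!σ) y)) = y := fun y => by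
    obtain ⟨y, rfl⟩ := hi.2 y
    rw [hF, F.symm_apply_apply]
  let T : C0 X X := (F.symm.toLinearMap ∘ₗ X.path σ,
    fun ρ => if ρ = σ then X.i ρ ∘ₗ F.symm.toLinearMap ∘ₗ X.o ρ else
      X.i ρ ∘ₗ F.symm.toLinearMap ∘ₗ X.path σ ∘ₗ F.symm.toLinearMap ∘ₗ X.o ρ,
    X.path σ ∘ₗ F.symm.toLinearMap)
  have hT : IsHom T := by
    refine ⟨fun ρ x => ?_, fun ρ x => ?_⟩ <;> obtain rfl | rfl := bool_cases σ ρ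
    · simp [T, SqRep.path]
    · simp [T, hF]
    · simp [T, SqRep.path]
    · simp [T, hF]
  obtain ⟨c, hc⟩ := h.scalar T hT
  have hb : ∀ x, F.symm (X.path σ x) = c • x :=
    LinearMap.congr_fun (congrArg Prod.fst hc)
  have hσ : ∀ x, X.i σ (F.symm (X.o σ x)) = c • x := fun x => by
    simpa [T] using LinearMap.congr_fun (congrArg (fun f : C0 X X => f.2.1 σ) hc) x
  by_cases h0 : c = 0
  · have := hb x
    rwa [h0, zero_smul, LinearEquiv.map_eq_zero_iff] at this
  · refine absurd (LinearEquiv.ofBijective (X.i σ) ⟨?_, fun y => ?_⟩).finrank_eq hs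
    · refine (injective_iff_map_eq_zero _).2 fun x hx => ?_
      have := hb x
      rw [SqRep.path, LinearMap.comp_apply, hx, map_zero, map_zero] at this
      exact (smul_eq_zero.1 this.symm).resolve_left h0
    · refine ⟨c⁻¹ • F.symm (X.o σ y), ?_⟩
      rw [map_smul, hσ, smul_smul, inv_mul_cancel₀ h0, one_smul]

/-- A rank-one map of `X.s σ` killing the range of `X.i σ`, with values in the kernel of `X.o σ`, is
a nonzero endomorphism that is zero at b. Being a scalar, it forces `X.b` to vanish. -/
theorem Exc.finrank_b_eq_zero (h : Exc X) {σ : Bool} (hi : ¬ Function.Surjective (X.i σ))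
    (ho : ¬ Function.Injective (X.o σ)) : finrank k X.b = 0 := by
  obtain ⟨ξ, hξ, hξi⟩ := Submodule.exists_le_ker_of_lt_top (range (X.i σ))
    (lt_top_iff_ne_top.2 fun h => hi (LinearMap.range_eq_top.1 h))
  obtain ⟨v, hv, hv0⟩ : ∃ v, X.o σ v = 0 ∧ v ≠ 0 := by
    by_contra! h; exact ho ((injective_iff_map_eq_zero _).2 h)
  let T : C0 X X := (0, Function.update 0 σ (ξ.smulRight v), 0)
  have hT : IsHom T := by
    refine ⟨fun ρ x => ?_, fun ρ x => ?_⟩ <;> obtain rfl | rfl := bool_cases σ ρ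
    · have : ξ (X.i ρ x) = 0 := hξi ⟨x, rfl⟩
      simp [T, this]
    · simp [T]
    · simp [T, hv]
    · simp [T]
  obtain ⟨c, hc⟩ := h.scalar T hT
  have hb : ∀ x : X.b, 0 = c • x := LinearMap.congr_fun (congrArg Prod.fst hc)
  have hσ : ∀ x, ξ x • v = c • x := fun x => by
    simpa [T] using LinearMap.congr_fun (congrArg (fun f : C0 X X => f.2.1 σ) hc) x
  have hc0 : c ≠ 0 := by
    rintro rfl
    refine hξ (LinearMap.ext fun x => ?_)
    have := hσ x
    rw [zero_smul] at this
    exact (smul_eq_zero.1 this).resolve_right hv0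
  rw [Module.finrank_zero_iff]
  exact ⟨fun x y => ((smul_eq_zero.1 (hb x).symm).resolve_left hc0).trans
    ((smul_eq_zero.1 (hb y).symm).resolve_left hc0).symm⟩

theorem IsR.exists_finrank (h : IsR X) : ∃ σ, finrank k (X.s !σ) = finrank k X.b ∧
    (finrank k (X.s σ) = finrank k X.b + 1 ∨ finrank k (X.s σ) + 1 = finrank k X.b) := by
  have hs := h.exc.sum_sq
  rw [Fintype.sum_bool, h.finrank_e] at hs
  have key : ∀ p q : ℤ, p ^ 2 + (-p) ^ 2 + (q ^ 2 + (-q) ^ 2) = 2 →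
      (q = 0 ∧ (p = -1 ∨ p = 1)) ∨ (p = 0 ∧ (q = -1 ∨ q = 1)) := by
    intro p q h
    obtain ⟨p1, p2⟩ := abs_le_one_of_sq_le (p := p) (by nlinarith [sq_nonneg q])
    obtain ⟨q1, q2⟩ := abs_le_one_of_sq_le (p := q) (by nlinarith [sq_nonneg p])
    interval_cases p <;> interval_cases q <;> simp_all
  simp only [← neg_sub (finrank k X.b : ℤ) (finrank k (X.s _))] at hs
  rcases key _ _ hs with h | h
  · exact ⟨true, by change finrank k (X.s false) = _ ∧ _; omega⟩
  · exact ⟨false, by change finrank k (X.s true) = _ ∧ _; omega⟩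

/-- The whole dimension jump sits at one `s σ`. An excess there kills `X.b`. A deficit makes the
path through `s σ` zero although it is a surjection followed by an injection, so `X.s σ` vanishes.
-/
theorem IsR.cases (h : IsR X) : ∃ σ, IsS σ X ∨ IsN σ X := by
  obtain ⟨σ, h1, h2⟩ := h.exists_finrank
  have he := h.finrank_e
  have hi := h.exc.i_injective_or_surjective
  have ho := h.exc.o_injective_or_surjective
  refine ⟨σ, h2.imp (fun h2 => ?_) fun h2 => ?_⟩
  · have := h.exc.finrank_b_eq_zero (σ := σ)
      (fun hs => by have := LinearMap.finrank_le_finrank_of_surjective hs; omega)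
      (fun hs => by have := LinearMap.finrank_le_finrank_of_injective hs; omega)
    constructor <;> omega
  · have hi' : Function.Bijective (X.i !σ) :=
      ⟨injective_of_or (hi _) (by omega), surjective_of_or (hi _) (by omega)⟩
    have ho' : Function.Bijective (X.o !σ) :=
      ⟨injective_of_or (ho _) (by omega), surjective_of_or (ho _) (by omega)⟩
    have hp := h.exc.path_eq_zero hi' ho' (by omega)
    have h0 : finrank k (X.s σ) = 0 := by
      have h3 : ∀ y : X.s σ, y = 0 := fun y => by
        obtain ⟨x, rfl⟩ := surjective_of_or (hi σ) (by omega) y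
        exact injective_of_or (ho σ) (by omega) ((hp x).trans (map_zero _).symm)
      rw [Module.finrank_zero_iff]
      exact ⟨fun x y => (h3 x).trans (h3 y).symm⟩
    exact ⟨by omega, by omega, h0, by omega, hi', ho'⟩

theorem IsR.exists_path_bijective (h : IsR X) : ∃ σ, Function.Bijective (X.path σ) := by
  obtain ⟨σ, h | h⟩ := h.cases
  · exact ⟨σ, fun x y _ => (eq_zero_of_finrank h.b x).trans (eq_zero_of_finrank h.b y).symm,
      fun y => ⟨0, (eq_zero_of_finrank h.e _).trans (eq_zero_of_finrank h.e y).symm⟩⟩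
  · exact ⟨_, h.path⟩

theorem IsS.homZ_isN {σ τ : Bool} (hX : IsS σ X) (hY : IsN τ Y) : HomZ X Y := fun f hf => by
  have he := ext_of_finrank_left hX.e f.2.2
  refine C0.eq_zero (ext_of_finrank_left hX.b _) (fun ρ => ?_) he
  obtain rfl | rfl := bool_cases τ ρ
  · exact ext_of_finrank_right hY.s _
  · refine LinearMap.ext fun x => hY.o.1 ?_
    rw [← hf.o, he]
    simp

theorem IsN.homZ_isS {σ τ : Bool} (hX : IsN τ X) (hY : IsS σ Y) : HomZ X Y := fun f hf => by
  have hb := ext_of_finrank_right hY.b f.1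
  refine C0.eq_zero hb (fun ρ => ?_) (ext_of_finrank_right hY.e _)
  obtain rfl | rfl := bool_cases τ ρ
  · exact ext_of_finrank_left hX.s _
  · refine LinearMap.ext fun x => ?_
    obtain ⟨x, rfl⟩ := hX.i.2 x
    rw [hf.i, hb]
    simp

theorem IsS.extZ_isS {σ τ : Bool} (hX : IsS σ X) (hY : IsS τ Y) : ExtZ X Y :=
  fun _ => ⟨0, Prod.ext (funext fun _ => (ext_of_finrank_left hX.b _).trans
    (ext_of_finrank_left hX.b _).symm) (funext fun _ => (ext_of_finrank_right hY.e _).trans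
    (ext_of_finrank_right hY.e _).symm)⟩

theorem IsN.homZ_isN {σ : Bool} (hX : IsN σ X) (hY : IsN (!σ) Y) : HomZ X Y := fun f hf => by
  have hs : ∀ ρ, f.2.1 ρ = 0 := fun ρ => by
    obtain rfl | rfl := bool_cases σ ρ
    · exact ext_of_finrank_left hX.s _
    · exact ext_of_finrank_right hY.s _
  refine C0.eq_zero (LinearMap.ext fun x => hY.i.1 ?_) hs (LinearMap.ext fun x => ?_)
  · rw [← hf.i, hs]
    simp
  · obtain ⟨x, rfl⟩ := hX.o.2 x
    rw [hf.o, hs]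
    simp

theorem injective_of_finrank_eq_one {V W : FGModuleCat.{u} k} {f : V →ₗ[k] W}
    (h : finrank k V = 1) (h0 : f ≠ 0) : Function.Injective f := by
  rw [← LinearMap.ker_eq_bot, ← Submodule.finrank_eq_zero]
  have := Submodule.finrank_lt (fun h => h0 (LinearMap.ker_eq_top.1 h))
  omega

theorem injective_of_finrank_eq_zero {V W : FGModuleCat.{u} k} {f : V →ₗ[k] W}
    (h : finrank k V = 0) : Function.Injective f :=
  fun x y _ => (eq_zero_of_finrank h x).trans (eq_zero_of_finrank h y).symm

/-- Nonzero maps exist only between objects of the same kind S σ or N σ, and they are determined on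
a one-dimensional space. -/
theorem IsR.isMono (hX : IsR X) (hY : IsR Y) {f : C0 X Y} (hf : IsHom f) (h0 : f ≠ 0) :
    IsMono f := by
  obtain ⟨σ, hX | hX⟩ := hX.cases <;> obtain ⟨τ, hY | hY⟩ := hY.cases
  · refine ⟨injective_of_finrank_eq_zero hX.b, fun ρ => ?_, injective_of_finrank_eq_zero hX.e⟩
    obtain rfl | rfl := bool_cases σ ρ
    · refine injective_of_finrank_eq_one hX.s fun h => h0 ?_
      refine C0.eq_zero (ext_of_finrank_left hX.b _) (fun τ => ?_) (ext_of_finrank_left hX.e _)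
      obtain rfl | rfl := bool_cases ρ τ
      · exact h
      · exact ext_of_finrank_left hX.s' _
    · exact injective_of_finrank_eq_zero hX.s'
  · exact absurd (hX.homZ_isN hY f hf) h0
  · exact absurd (hX.homZ_isS hY f hf) h0
  · obtain rfl | rfl := bool_cases σ τ
    · have hb : f.1 ≠ 0 := fun hb => h0 <| by
        have hs : ∀ ρ, f.2.1 ρ = 0 := fun ρ => by
          obtain rfl | rfl := bool_cases τ ρ
          · exact ext_of_finrank_left hX.s _
          · refine LinearMap.ext fun x => ?_
            obtain ⟨x, rfl⟩ := hX.i.2 x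
            rw [hf.i, hb]
            simp
        refine C0.eq_zero hb hs (LinearMap.ext fun x => ?_)
        obtain ⟨x, rfl⟩ := hX.o.2 x
        rw [hf.o, hs]
        simp
      have hb' := injective_of_finrank_eq_one hX.b hb
      refine ⟨hb', fun ρ => ?_, ?_⟩
      · obtain rfl | rfl := bool_cases τ ρ
        · exact injective_of_finrank_eq_zero hX.s
        · refine (injective_iff_map_eq_zero _).2 fun x hx => ?_
          obtain ⟨x, rfl⟩ := hX.i.2 x
          rw [hf.i] at hx
          rw [hb' (hY.i.1 (hx.trans (map_zero _).symm) |>.trans (map_zero f.1).symm), map_zero]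
      · refine (injective_iff_map_eq_zero _).2 fun x hx => ?_
        obtain ⟨x, rfl⟩ := hX.path.2 x
        rw [hf.path] at hx
        rw [hb' (hY.path.1 (hx.trans (map_zero _).symm) |>.trans (map_zero f.1).symm), map_zero]
    · exact absurd (hX.homZ_isN hY f hf) h0

end SqRep

/-! ### Ext-nontrivial couples and the RP properties on the square -/

namespace SqRep

open Module LinearMap

variable {k : Type u} [Field k] {X Y Z : SqRep k}

theorem IsR.extZ_of_not_homZ (hX : IsR X) (hY : IsR Y) (h : ¬ HomZ X Y) : ExtZ X Y := by
  obtain ⟨f, hf, h0⟩ := not_homZ.1 h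
  exact (hX.isMono hY hf h0).extZ hf hY.exc.ext

theorem IsR.isEpi (hX : IsR X) (hY : IsR Y) {f : C0 X Y} (hf : IsHom f) (h0 : f ≠ 0) :
    IsEpi f := by
  have hm := hX.isMono hY hf h0
  have key : finrank k X.b = finrank k Y.b ∧ (∀ ρ, finrank k (X.s ρ) = finrank k (Y.s ρ)) ∧
      finrank k X.e = finrank k Y.e := by
    obtain ⟨σ, hX | hX⟩ := hX.cases <;> obtain ⟨τ, hY | hY⟩ := hY.cases
    · have h1 := LinearMap.finrank_le_finrank_of_injective (hm.s σ)
      rw [hX.s] at h1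
      obtain rfl | rfl := bool_cases σ τ
      · refine ⟨hX.b.trans hY.b.symm, fun ρ => ?_, hX.e.trans hY.e.symm⟩
        obtain rfl | rfl := bool_cases τ ρ
        · exact hX.s.trans hY.s.symm
        · exact hX.s'.trans hY.s'.symm
      · have := hY.s'
        rw [Bool.not_not] at this
        omega
    · exact absurd (hX.homZ_isN hY f hf) h0
    · exact absurd (hX.homZ_isS hY f hf) h0
    · obtain rfl | rfl := bool_cases σ τ
      · refine ⟨hX.b.trans hY.b.symm, fun ρ => ?_, hX.e.trans hY.e.symm⟩
        obtain rfl | rfl := bool_cases τ ρ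
        · exact hX.s.trans hY.s.symm
        · exact hX.s'.trans hY.s'.symm
      · exact absurd (hX.homZ_isN hY f hf) h0
  exact ⟨(LinearMap.injective_iff_surjective_of_finrank_eq_finrank key.1).1 hm.b,
    fun ρ => (LinearMap.injective_iff_surjective_of_finrank_eq_finrank (key.2.1 ρ)).1 (hm.s ρ),
    (LinearMap.injective_iff_surjective_of_finrank_eq_finrank key.2.2).1 hm.e⟩

theorem IsR.extZ_of_euler_nonneg (hX : IsR X) (hY : IsR Y) (h : 0 ≤ euler X Y) : ExtZ X Y := by
  by_cases h0 : HomZ X Y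
  · exact h0.extZ (h0.euler_nonpos.antisymm h)
  · exact hX.extZ_of_not_homZ hY h0

/-- The members of an Ext-nontrivial couple are, up to order, of types `S σ` and `N σ`. -/
theorem IsR.couple (hX : IsR X) (hY : IsR Y) (h : ¬ ExtZ X Y) :
    ∃ σ, (IsS σ X ∧ IsN σ Y) ∨ (IsN σ X ∧ IsS σ Y) := by
  -- The Euler form must be negative, which leaves only S σ against N σ; a pair of simples is
  -- excluded directly.
  have he := mt (hX.extZ_of_euler_nonneg hY) h
  obtain ⟨σ, hX | hX⟩ := hX.cases <;> obtain ⟨τ, hY | hY⟩ := hY.cases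
  · exact absurd (hX.extZ_isS hY) h
  · obtain rfl | rfl := bool_cases σ τ
    · exact ⟨_, Or.inl ⟨hX, hY⟩⟩
    · have hs := hY.s'
      rw [Bool.not_not] at hs
      simp [euler_eq X Y σ, hX.b, hX.e, hX.s, hX.s', hY.b, hY.e, hY.s, hs] at he
  · obtain rfl | rfl := bool_cases σ τ
    · exact ⟨_, Or.inr ⟨hX, hY⟩⟩
    · have hs := hY.s'
      rw [Bool.not_not] at hs
      simp [euler_eq X Y σ, hX.b, hX.e, hX.s, hX.s', hY.b, hY.e, hY.s, hs] at he
  · obtain rfl | rfl := bool_cases σ τ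
    · simp [euler_eq X Y τ, hX.b, hX.e, hX.s, hX.s', hY.b, hY.e, hY.s, hY.s'] at he
    · have hs := hY.s'
      rw [Bool.not_not] at hs
      simp [euler_eq X Y σ, hX.b, hX.e, hX.s, hX.s', hY.b, hY.e, hY.s, hs] at he

theorem IsP.extZ_of_homZ (hX : IsP X) (h : HomZ Y X) : ExtZ X Y := by
  by_contra h'
  exact hX.not_homZ h' h

theorem IsI.extZ_of_homZ (hY : IsI Y) (h : HomZ Y X) : ExtZ X Y := by
  by_contra h'
  exact hY.not_homZ h' h

section IsAlgClosed

variable [IsAlgClosed k]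

theorem IsR.homZ_isP (hX : IsR X) (hY : IsP Y) : HomZ X Y := by
  obtain ⟨σ, h⟩ := hX.exists_path_bijective
  exact hY.homZ_of_path_surjective h.2

theorem IsI.homZ_isP (hX : IsI X) (hY : IsP Y) : HomZ X Y :=
  hY.homZ_of_path_surjective (hX.path_surjective true)

theorem IsI.homZ_isR (hX : IsI X) (hY : IsR Y) : HomZ X Y := by
  obtain ⟨σ, h⟩ := hY.exists_path_bijective
  exact hX.homZ_of_path_injective h.1

/-- At most one of `Hom(X, Y)` and `Ext¹(X, Y)` is nonzero. -/
theorem Exc.homZ_or_extZ (hX : Exc X) (hY : Exc Y) : HomZ X Y ∨ ExtZ X Y := by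
  rcases hX.type with hX' | hX' | hX' <;> rcases hY.type with hY' | hY' | hY'
  · refine or_iff_not_imp_left.2 fun h => ?_
    obtain ⟨f, hf, h0⟩ := not_homZ.1 h
    exact (hX'.isMono hY' hf h0).extZ hf hY.ext
  · exact Or.inr (hX'.extZ_of_homZ (hY'.homZ_isP hX'))
  · exact Or.inr (hX'.extZ_of_homZ (hY'.homZ_isP hX'))
  · exact Or.inl (hX'.homZ_isP hY')
  · refine or_iff_not_imp_left.2 fun h => ?_
    obtain ⟨f, hf, h0⟩ := not_homZ.1 h
    exact (hX'.isEpi hY' hf h0).extZ hf hX.ext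
  · exact Or.inl (hX'.homZ_isR hY')
  · exact Or.inl (hX'.homZ_isP hY')
  · exact Or.inr (hY'.extZ_of_homZ (hY'.homZ_isR hX'))
  · exact or_iff_not_imp_left.2 (hX'.extZ_of_not_homZ hY')

/-- The members of an Ext-nontrivial couple have defect zero. -/
theorem Exc.isR_of_not_extZ (hX : Exc X) (hY : Exc Y) (h : ¬ ExtZ X Y) (h' : ¬ ExtZ Y X) :
    IsR X ∧ IsR Y := by
  rcases hX.type with hX' | hX' | hX' <;> rcases hY.type with hY' | hY' | hY'
  · exact absurd ((hY.homZ_or_extZ hX).resolve_right h') (hX'.not_homZ h)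
  · exact absurd (hY'.homZ_isP hX') (hX'.not_homZ h)
  · exact absurd (hY'.homZ_isP hX') (hX'.not_homZ h)
  · exact absurd (hX'.homZ_isP hY') (hY'.not_homZ h')
  · exact absurd ((hY.homZ_or_extZ hX).resolve_right h') (hY'.not_homZ h)
  · exact absurd (hX'.homZ_isR hY') (hX'.not_homZ h')
  · exact absurd (hX'.homZ_isP hY') (hY'.not_homZ h')
  · exact absurd (hY'.homZ_isR hX') (hY'.not_homZ h)
  · exact ⟨hX', hY'⟩

theorem Exc.couple (hX : Exc X) (hY : Exc Y) (h : ¬ ExtZ X Y) (h' : ¬ ExtZ Y X) :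
    ∃ σ, (IsS σ X ∧ IsN σ Y) ∨ (IsN σ X ∧ IsS σ Y) :=
  have hR := hX.isR_of_not_extZ hY h h'
  hR.1.couple hR.2 h

end IsAlgClosed

theorem IsS.o_injective {σ : Bool} (hX : IsS σ X) (h : HomZ X Y) :
    Function.Injective (Y.o σ) := by
  refine (injective_iff_map_eq_zero _).2 fun v hv => ?_
  have : Nontrivial (X.s σ) := Module.nontrivial_of_finrank_pos (R := k) (by rw [hX.s]; simp)
  obtain ⟨x, hx⟩ := exists_ne (0 : X.s σ)
  obtain ⟨ξ, hξ⟩ := Projective.exists_dual_eq_one k hx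
  have hf : IsHom (X := X) (Y := Y) (0, Function.update 0 σ (ξ.smulRight v), 0) := by
    refine ⟨fun ρ x => ?_, fun ρ x => ?_⟩
    · simp [eq_zero_of_finrank hX.b x]
    · obtain rfl | rfl := bool_cases σ ρ
      · simp [hv]
      · simp
  have := LinearMap.congr_fun (congrArg (fun f : C0 X Y => f.2.1 σ) (h _ hf)) x
  simpa [hξ] using this

/-- A vector in the kernel of `Y.i σ` generates a map from N σ, transported along the bijective path
of `X`. -/
theorem IsN.i_injective {σ : Bool} (hX : IsN σ X) (h : HomZ X Y) :
    Function.Injective (Y.i σ) := by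
  refine (injective_iff_map_eq_zero _).2 fun v hv => ?_
  have : Nontrivial X.b := Module.nontrivial_of_finrank_pos (R := k) (by rw [hX.b]; simp)
  obtain ⟨x, hx⟩ := exists_ne (0 : X.b)
  obtain ⟨ξ, hξ⟩ := Projective.exists_dual_eq_one k hx
  let F := LinearEquiv.ofBijective _ hX.path
  have hF : ∀ x, X.o (!σ) (X.i (!σ) x) = F x := fun _ => rfl
  let g : X.b →ₗ[k] Y.b := ξ.smulRight v
  have hf : IsHom (X := X) (Y := Y) (g, fun ρ => Y.i ρ ∘ₗ g ∘ₗ F.symm.toLinearMap ∘ₗ X.o ρ,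
      Y.path (!σ) ∘ₗ g ∘ₗ F.symm.toLinearMap) := by
    refine ⟨fun ρ x => ?_, fun ρ x => ?_⟩ <;> obtain rfl | rfl := bool_cases σ ρ
    · simp [eq_zero_of_finrank hX.s (X.i ρ x), g, hv]
    · simp [hF]
    · simp [eq_zero_of_finrank hX.s x]
    · simp [SqRep.path]
  have := LinearMap.congr_fun (congrArg Prod.fst (h _ hf)) x
  simpa [g, hξ] using this

/-- Here χ(Γ, X) = dim s σ − dim e, so `X.o σ` is bijective. A map from `X` to N σ vanishes at s σ,
hence at e, hence everywhere; and χ(X, Γ') = −χ(Γ, X) = 0. -/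
theorem IsS.homZ_extZ {σ : Bool} {Γ Γ' : SqRep k} (hΓ : IsS σ Γ) (hΓ' : IsN σ Γ')
    (h : HomZ Γ X) (h' : ExtZ Γ X) : HomZ X Γ' ∧ ExtZ X Γ' := by
  have he := h.euler_eq_zero h'
  simp only [euler_eq Γ X σ, hΓ.b, hΓ.e, hΓ.s, hΓ.s'] at he
  have hs := (LinearMap.injective_iff_surjective_of_finrank_eq_finrank (by omega)).1
    (hΓ.o_injective h)
  have hz : HomZ X Γ' := fun f hf => by
    have h1 : f.2.1 σ = 0 := ext_of_finrank_right hΓ'.s _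
    have h2 : f.2.2 = 0 := LinearMap.ext fun x => by
      obtain ⟨x, rfl⟩ := hs x
      rw [hf.o, h1]
      simp
    have h3 : f.2.1 (!σ) = 0 := LinearMap.ext fun x => hΓ'.o.1 (by rw [← hf.o, h2]; simp)
    refine C0.eq_zero (LinearMap.ext fun x => hΓ'.i.1 (by rw [← hf.i, h3]; simp)) (fun ρ => ?_) h2
    obtain rfl | rfl := bool_cases σ ρ
    exacts [h1, h3]
  refine ⟨hz, hz.extZ ?_⟩
  simp only [euler_eq X Γ' σ, hΓ'.b, hΓ'.e, hΓ'.s, hΓ'.s']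
  push_cast at he ⊢
  linarith

theorem IsN.homZ_extZ {σ : Bool} {Γ Γ' : SqRep k} (hΓ : IsN σ Γ) (hΓ' : IsS σ Γ')
    (h : HomZ Γ X) (h' : ExtZ Γ X) : HomZ X Γ' ∧ ExtZ X Γ' := by
  have he := h.euler_eq_zero h'
  simp only [euler_eq Γ X σ, hΓ.b, hΓ.e, hΓ.s, hΓ.s'] at he
  have hs := (LinearMap.injective_iff_surjective_of_finrank_eq_finrank (by omega)).1
    (hΓ.i_injective h)
  have hz : HomZ X Γ' := fun f hf => by
    have h1 : f.1 = 0 := ext_of_finrank_right hΓ'.b _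
    refine C0.eq_zero h1 (fun ρ => ?_) (ext_of_finrank_right hΓ'.e _)
    obtain rfl | rfl := bool_cases σ ρ
    · refine LinearMap.ext fun x => ?_
      obtain ⟨x, rfl⟩ := hs x
      rw [hf.i, h1]
      simp
    · exact ext_of_finrank_right hΓ'.s' _
  refine ⟨hz, hz.extZ ?_⟩
  simp only [euler_eq X Γ' σ, hΓ'.b, hΓ'.e, hΓ'.s, hΓ'.s']
  push_cast at he ⊢
  linarith

theorem Exc.homZ_extZ_of_couple [IsAlgClosed k] {Γ Γ' : SqRep k} (hΓ : Exc Γ) (hΓ' : Exc Γ')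
    (h1 : ¬ ExtZ Γ Γ') (h2 : ¬ ExtZ Γ' Γ) (h : HomZ Γ X) (h' : ExtZ Γ X) :
    HomZ X Γ' ∧ ExtZ X Γ' := by
  obtain ⟨σ, ⟨hS, hN⟩ | ⟨hN, hS⟩⟩ := hΓ.couple hΓ' h1 h2
  · exact hS.homZ_extZ hN h h'
  · exact hN.homZ_extZ hS h h'

theorem Exc.not_homZ_of_couple [IsAlgClosed k] {Γ Γ' : SqRep k} (hΓ : Exc Γ) (hΓ' : Exc Γ')
    (h1 : ¬ ExtZ Γ Γ') (h2 : ¬ ExtZ Γ' Γ) (hX : Exc X) (hY : Exc Y) (hΓX : ¬ HomZ Γ X)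
    (hXY : ¬ HomZ X Y) (h : HomZ Γ Y) (h' : ExtZ Γ Y) : ¬ HomZ Γ' Y := by
  have hR := (hΓ.isR_of_not_extZ hΓ' h1 h2).1
  rcases hX.type with hX' | hX' | hX'
  · exact absurd (hR.homZ_isP hX') hΓX
  · have hY' : IsI Y := by
      rcases hY.type with hY' | hY' | hY'
      · exact absurd (hX'.homZ_isP hY') hXY
      · exact hY'
      · exact absurd (hX'.homZ_isR hY') hXY
    intro hz
    -- The Euler forms of S σ and N σ against `Y` add up to dim b − dim e = 1, so they cannot be 0
    -- and nonpositive.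
    have hn := hz.euler_nonpos
    have he := h.euler_eq_zero h'
    have hd := hY'.finrank_b
    obtain ⟨σ, ⟨hS, hN⟩ | ⟨hN, hS⟩⟩ := hΓ.couple hΓ' h1 h2 <;>
    · simp only [euler_eq _ Y σ, hS.b, hS.e, hS.s, hS.s', hN.b, hN.e, hN.s, hN.s', hd] at he hn
      push_cast at he hn
      linarith
  · obtain ⟨f, hf, hf0⟩ := not_homZ.1 hΓX
    obtain ⟨g, hg, hg0⟩ := not_homZ.1 hXY
    -- The nonzero map Γ ⟶ X is epi, so the composite with X ⟶ Y would be a nonzero map Γ ⟶ Y.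
    have hep := hR.isEpi hX' hf hf0
    have hz := h (g.1 ∘ₗ f.1, fun σ => g.2.1 σ ∘ₗ f.2.1 σ, g.2.2 ∘ₗ f.2.2)
      ⟨fun σ x => by simp [hf.i, hg.i], fun σ x => by simp [hf.o, hg.o]⟩
    refine absurd (C0.eq_zero (LinearMap.ext fun x => ?_) (fun σ => LinearMap.ext fun x => ?_)
      (LinearMap.ext fun x => ?_)) hg0
    · obtain ⟨x, rfl⟩ := hep.b x
      exact LinearMap.congr_fun (congrArg Prod.fst hz) x
    · obtain ⟨x, rfl⟩ := hep.s σ x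
      exact LinearMap.congr_fun (congrArg (fun f : C0 Γ Y => f.2.1 σ) hz) x
    · obtain ⟨x, rfl⟩ := hep.e x
      exact LinearMap.congr_fun (congrArg (fun f : C0 Γ Y => f.2.2) hz) x

end SqRep

/-! ### Ext groups of quiver representations in terms of linear maps -/

namespace QuiverRep

open Limits

variable {k : Type u} [Field k] {Q : Type} [Quiver.{0} Q]

/-- The space at a vertex. -/
abbrev sp (X : QuiverRep k Q) (i : Q) : FGModuleCat.{u} k := X.obj ((Paths.of Q).obj i)

/-- The linear map along an arrow. -/
def lin (X : QuiverRep k Q) {i j : Q} (α : i ⟶ j) : X.sp i →ₗ[k] X.sp j :=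
  (X.map ((Paths.of Q).map α)).hom.hom

/-- The linear map of a morphism at a vertex. -/
def comp {X Y : QuiverRep k Q} (f : X ⟶ Y) (i : Q) : X.sp i →ₗ[k] Y.sp i :=
  (f.app ((Paths.of Q).obj i)).hom.hom

variable {X Y Z : QuiverRep k Q}

theorem comp_lin (f : X ⟶ Y) {i j : Q} (α : i ⟶ j) (x : X.sp i) :
    comp f j (X.lin α x) = Y.lin α (comp f i x) :=
  LinearMap.congr_fun (congrArg (fun g => g.hom.hom) (f.naturality ((Paths.of Q).map α))) x

/-- A morphism of representations from compatible linear maps. -/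
def mkHom (g : ∀ i : Q, X.sp i →ₗ[k] Y.sp i)
    (h : ∀ {i j : Q} (α : i ⟶ j) (x : X.sp i), g j (X.lin α x) = Y.lin α (g i x)) : X ⟶ Y where
  app j := ObjectProperty.homMk (ModuleCat.ofHom (g j))
  naturality i j p := by
    induction p using Paths.induction with
    | id => simp
    | comp p α hp =>
      rw [X.map_comp, Y.map_comp, Category.assoc]
      have this : X.map ((Paths.of Q).map α) ≫ ObjectProperty.homMk (ModuleCat.ofHom (g _)) =
          ObjectProperty.homMk (ModuleCat.ofHom (g _)) ≫ Y.map ((Paths.of Q).map α) :=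
        FGModuleCat.hom_ext (LinearMap.ext (h α))
      exact (congrArg (X.map p ≫ ·) this).trans ((Category.assoc _ _ _).symm.trans
        ((congrArg (· ≫ Y.map ((Paths.of Q).map α)) hp).trans (Category.assoc _ _ _)))

@[simp]
theorem comp_mkHom (g : ∀ i : Q, X.sp i →ₗ[k] Y.sp i)
    (h : ∀ {i j : Q} (α : i ⟶ j) (x : X.sp i), g j (X.lin α x) = Y.lin α (g i x)) (i : Q) :
    comp (mkHom g h) i = g i := rfl

@[simp]
theorem comp_comp (f : X ⟶ Y) (g : Y ⟶ Z) (i : Q) : comp (f ≫ g) i = comp g i ∘ₗ comp f i := rfl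

theorem hom_ext {f g : X ⟶ Y} (h : ∀ i x, comp f i x = comp g i x) : f = g :=
  NatTrans.ext (funext fun i => FGModuleCat.hom_ext (LinearMap.ext (h i)))

theorem comp_surjective (f : X ⟶ Y) [Epi f] (i : Q) : Function.Surjective (comp f i) := by
  have : Epi (f.app ((Paths.of Q).obj i)) := inferInstance
  have : Epi ((forget₂ (FGModuleCat.{u} k) (ModuleCat k)).map (f.app ((Paths.of Q).obj i))) :=
    inferInstance
  exact (ModuleCat.epi_iff_surjective _).1 this

theorem epi_of_surjective (f : X ⟶ Y) (h : ∀ i, Function.Surjective (comp f i)) : Epi f :=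
  ⟨fun u v huv => hom_ext fun i y => by
    obtain ⟨x, rfl⟩ := h i y
    exact LinearMap.congr_fun (congrArg (fun f => comp f i) huv) x⟩

section Exact

variable {S : ShortComplex (QuiverRep k Q)} (hS : S.ShortExact)

include hS

theorem shortExact_at (i : Q) : ((S.map ((evaluation _ _).obj ((Paths.of Q).obj i))).map
    (forget₂ (FGModuleCat.{u} k) (ModuleCat k))).ShortExact :=
  (hS.map_of_exact _).map_of_exact _

theorem comp_injective_of_shortExact (i : Q) : Function.Injective (comp S.f i) :=
  (shortExact_at hS i).moduleCat_injective_f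

theorem comp_surjective_of_shortExact (i : Q) : Function.Surjective (comp S.g i) :=
  (shortExact_at hS i).moduleCat_surjective_g

theorem exists_of_comp_eq_zero (i : Q) (x : S.X₂.sp i) (hx : comp S.g i x = 0) :
    ∃ y, comp S.f i y = x :=
  (ShortComplex.moduleCat_exact_iff _).1 (shortExact_at hS i).exact x hx

end Exact

/-- The vanishing of `Ext¹(X, Y)`, in terms of linear maps. -/
def ExtZ (X Y : QuiverRep k Q) : Prop :=
  ∀ φ : ∀ {i j : Q}, (i ⟶ j) → (X.sp i →ₗ[k] Y.sp j), ∃ g : ∀ i : Q, X.sp i →ₗ[k] Y.sp i,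
    ∀ {i j : Q} (α : i ⟶ j) (x : X.sp i), g j (X.lin α x) - Y.lin α (g i x) = φ α x

theorem exists_rep (V : Q → FGModuleCat.{u} k) (m : ∀ {i j : Q}, (i ⟶ j) → (V i →ₗ[k] V j)) :
    ∃ (E : QuiverRep k Q) (e : ∀ i, E.sp i ≃ₗ[k] V i),
      ∀ {i j : Q} (α : i ⟶ j) (x : E.sp i), e j (E.lin α x) = m α (e i x) := by
  refine ⟨Paths.lift ⟨V, fun α => ObjectProperty.homMk (ModuleCat.ofHom (m α))⟩,
    fun i => LinearEquiv.refl k (V i), fun α x => ?_⟩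
  exact LinearMap.congr_fun (congrArg (fun g => g.hom.hom) (Paths.lift_toPath
    ⟨V, fun {i j} (α : i ⟶ j) => ObjectProperty.homMk (ModuleCat.ofHom (m α))⟩ α)) x

/-- The extension is Y ⊕ X at each vertex, with triangular arrows having `φ` off the diagonal; `p`
and `s` are its vertexwise splittings. -/
theorem exists_extension (φ : ∀ {i j : Q}, (i ⟶ j) → (X.sp i →ₗ[k] Y.sp j)) :
    ∃ (E : QuiverRep k Q) (f : Y ⟶ E) (g : E ⟶ X) (p : ∀ i, E.sp i →ₗ[k] Y.sp i)
      (s : ∀ i, X.sp i →ₗ[k] E.sp i), (∀ i y, p i (comp f i y) = y) ∧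
      (∀ i y, comp g i (comp f i y) = 0) ∧ (∀ i x, comp g i (s i x) = x) ∧
      (∀ i x, comp g i x = 0 → comp f i (p i x) = x) ∧
      ∀ {i j : Q} (α : i ⟶ j) (x : X.sp i),
        E.lin α (s i x) = s j (X.lin α x) + comp f j (φ α x) := by
  obtain ⟨E, e, he⟩ := exists_rep (k := k) (Q := Q) (fun i => FGModuleCat.of k (Y.sp i × X.sp i))
    (fun {i _} α => (((Y.lin α).coprod (φ α)).prod (X.lin α ∘ₗ LinearMap.snd k (Y.sp i) (X.sp i))))
  replace he : ∀ {i j : Q} (α : i ⟶ j) (x : E.sp i), e j (E.lin α x) =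
    (Y.lin α (e i x).1 + φ α (e i x).2, X.lin α (e i x).2) := he
  have he' : ∀ {i j : Q} (α : i ⟶ j) (x : Y.sp i × X.sp i), E.lin α ((e i).symm x) =
      (e j).symm (Y.lin α x.1 + φ α x.2, X.lin α x.2) := fun α x => by
    rw [LinearEquiv.eq_symm_apply, he, LinearEquiv.apply_symm_apply]
  have hs : ∀ i (x : Y.sp i × X.sp i), e i ((e i).symm x) = x :=
    fun i x => (e i).apply_symm_apply x
  refine ⟨E, mkHom (fun i => (e i).symm.toLinearMap ∘ₗ LinearMap.inl k (Y.sp i) (X.sp i))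
    fun α x => ?_, mkHom (fun i => LinearMap.snd k (Y.sp i) (X.sp i) ∘ₗ (e i).toLinearMap)
    fun α x => congrArg Prod.snd (he α x), fun i => LinearMap.fst k (Y.sp i) (X.sp i) ∘ₗ
    (e i).toLinearMap, fun i => (e i).symm.toLinearMap ∘ₗ LinearMap.inr k (Y.sp i) (X.sp i),
    fun i y => congrArg Prod.fst (hs i (y, 0)), fun i y => congrArg Prod.snd (hs i (y, 0)),
    fun i x => congrArg Prod.snd (hs i (0, x)), fun i x hx => ?_, fun {i j} α x => ?_⟩
  · simp [he']
  · change (e i x).2 = 0 at hx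
    change (e i).symm ((e i x).1, 0) = x
    rw [LinearEquiv.symm_apply_eq, ← hx]
  · change E.lin α ((e i).symm (0, x)) = (e j).symm (0, X.lin α x) + (e j).symm (φ α x, 0)
    rw [he', ← map_add]
    simp

open Abelian in
theorem extZ_of_subsingleton (h : Subsingleton (Ext X Y 1)) : ExtZ X Y := by
  intro φ
  obtain ⟨E, f, g, p, s, hpf, hgf, hgs, hfp, hE⟩ := exists_extension φ
  have hf : ∀ i, Function.Injective (comp f i) := fun i x y hxy => by
    rw [← hpf i x, hxy, hpf]
  have w : f ≫ g = 0 := hom_ext fun i x => hgf i x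
  have : Epi g := epi_of_surjective g fun i x => ⟨s i x, hgs i x⟩
  have : Mono f := ⟨fun u v huv => hom_ext fun i x => hf i
    (LinearMap.congr_fun (congrArg (fun f => comp f i) huv) x)⟩
  have hS : (ShortComplex.mk f g w).ShortExact :=
    { exact := ShortComplex.exact_of_f_is_kernel _ <| KernelFork.IsLimit.ofι' f w fun {T} t ht => by
        have ht' : ∀ i x, comp f i (p i (comp t i x)) = comp t i x := fun i x =>
          hfp i _ (LinearMap.congr_fun (congrArg (fun f => comp f i) ht) x)
        refine ⟨mkHom (fun i => p i ∘ₗ comp t i) fun {i j} α x => hf j ?_,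
          hom_ext fun i x => ht' i x⟩
        change comp f j (p j (comp t j (T.lin α x))) = comp f j (Y.lin α (p i (comp t i x)))
        rw [ht', comp_lin, comp_lin, ht'] }
  -- The obstruction to lifting the identity of `X` through `g` lies in Ext¹(X, Y) = 0, so the
  -- extension splits.
  obtain ⟨r, hr⟩ := Ext.covariant_sequence_exact₃ _ hS (Ext.mk₀ (𝟙 X)) (zero_add 1)
    (Subsingleton.elim _ _)
  obtain ⟨r, rfl⟩ := Ext.homEquiv₀.symm.surjective r
  have hr' : r ≫ g = 𝟙 X := Ext.homEquiv₀.symm.injective (by simpa using hr)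
  have hgr : ∀ i x, comp g i (comp r i x) = x := fun i x =>
    LinearMap.congr_fun (congrArg (fun f => comp f i) hr') x
  have hfr : ∀ i x, comp f i (p i (comp r i x - s i x)) = comp r i x - s i x := fun i x =>
    hfp i _ (by rw [map_sub, hgr, hgs, sub_self])
  -- The section `r` commutes with the arrows and `s` fails to by `φ`, so their difference, which
  -- lies in `Y`, has coboundary `φ`.
  refine ⟨fun i => p i ∘ₗ (comp r i - s i), fun {i j} α x => hf j ?_⟩
  change comp f j (p j (comp r j (X.lin α x) - s j (X.lin α x)) -
    Y.lin α (p i (comp r i x - s i x))) = comp f j (φ α x)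
  rw [map_sub, comp_lin f, hfr, hfr, map_sub, comp_lin, hE]
  abel

section Presentation

variable {S : ShortComplex (QuiverRep k Q)} (hS : S.ShortExact)

include hS

/-- If `Ext¹(X₃, Y)` vanishes, then maps from `X₁` to `Y` extend along `X₁ ⟶ X₂`. -/
theorem ExtZ.exists_extend (h : ExtZ S.X₃ Y) (f : S.X₁ ⟶ Y) : ∃ g : S.X₂ ⟶ Y, S.f ≫ g = f := by
  choose r hr using fun i => LinearMap.exists_leftInverse_apply (comp_injective_of_shortExact hS i)
  choose t ht using fun i => LinearMap.exists_rightInverse_apply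
    (comp_surjective_of_shortExact hS i)
  have hz : ∀ i y, comp S.g i (comp S.f i y) = 0 := fun i y =>
    LinearMap.congr_fun (congrArg (fun f => comp f i) S.zero) y
  -- This cochain measures how far the vertexwise extension of `f` is from a morphism; a solution
  -- `g` corrects it.
  obtain ⟨g, hg⟩ := h fun {i j} α =>
    (comp f j ∘ₗ r j ∘ₗ S.X₂.lin α - Y.lin α ∘ₗ comp f i ∘ₗ r i) ∘ₗ t i
  refine ⟨mkHom (fun i => comp f i ∘ₗ r i - g i ∘ₗ comp S.g i) fun {i j} α x => ?_,
    hom_ext fun i x => ?_⟩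
  · obtain ⟨y, hy⟩ := exists_of_comp_eq_zero hS i (x - t i (comp S.g i x))
      (by rw [map_sub, ht, sub_self])
    have hx : x = t i (comp S.g i x) + comp S.f i y := by rw [hy]; abel
    have h1 := hg α (comp S.g i x)
    change _ = comp f j (r j (S.X₂.lin α (t i (comp S.g i x)))) -
      Y.lin α (comp f i (r i (t i (comp S.g i x)))) at h1
    change comp f j (r j (S.X₂.lin α x)) - g j (comp S.g j (S.X₂.lin α x)) =
      Y.lin α (comp f i (r i x) - g i (comp S.g i x))
    have h2 : comp f j (r j (S.X₂.lin α x)) = comp f j (r j (S.X₂.lin α (t i (comp S.g i x)))) +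
        comp f j (S.X₁.lin α y) := by
      conv_lhs => rw [hx, map_add, map_add, map_add, ← comp_lin, hr]
    have h3 : comp f i (r i x) = comp f i (r i (t i (comp S.g i x))) + comp f i y := by
      conv_lhs => rw [hx, map_add, map_add, hr]
    rw [h2, h3, map_sub, map_add, comp_lin f, comp_lin S.g, sub_eq_iff_eq_add.1 h1.symm]
    abel
  · change comp f i (r i (comp S.f i x)) - g i (comp S.g i (comp S.f i x)) = comp f i x
    rw [hr, hz, map_zero, sub_zero]

/-- `Ext¹(-, Y)` is right exact. -/
theorem ExtZ.of_shortExact (h : ExtZ S.X₂ Y) : ExtZ S.X₁ Y := by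
  intro φ
  choose r hr using fun i => LinearMap.exists_leftInverse_apply (comp_injective_of_shortExact hS i)
  obtain ⟨g, hg⟩ := h fun {i _} α => φ α ∘ₗ r i
  refine ⟨fun i => g i ∘ₗ comp S.f i, fun {i j} α x => ?_⟩
  change g j (comp S.f j (S.X₁.lin α x)) - Y.lin α (g i (comp S.f i x)) = φ α x
  rw [comp_lin, hg]
  exact congrArg (φ α) (hr i x)

open Abelian

/-- As Ext¹(X₂, Y) = 0, every class comes from a map X₁ ⟶ Y. That map extends to X₂, and its product
with the extension class is zero. -/
theorem subsingleton_of_extZ [Projective S.X₂] (h : ExtZ S.X₃ Y) : Subsingleton (Ext S.X₃ Y 1) := by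
  refine subsingleton_of_forall_eq 0 fun x => ?_
  obtain ⟨f, rfl⟩ := Ext.contravariant_sequence_exact₃ hS Y x
    (Ext.eq_zero_of_projective (n := 0) _) (add_zero 1)
  obtain ⟨f, rfl⟩ := Ext.homEquiv₀.symm.surjective f
  obtain ⟨g, rfl⟩ := h.exists_extend hS f
  have : Ext.homEquiv₀.symm (S.f ≫ g) = (Ext.mk₀ S.f).comp (Ext.mk₀ g) (zero_add 0) := by simp
  rw [this, ← Ext.comp_assoc_of_second_deg_zero, hS.extClass_comp, Ext.zero_comp]

end Presentation

open Abelian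

variable [EnoughProjectives (QuiverRep k Q)]

theorem subsingleton_ext_one_iff : Subsingleton (Ext X Y 1) ↔ ExtZ X Y :=
  ⟨extZ_of_subsingleton, fun h => subsingleton_of_extZ (S := ShortComplex.mk _ (Projective.π X)
    (kernel.condition _)) { exact := ShortComplex.exact_kernel _ } h⟩

/-- The category of representations is hereditary. -/
theorem subsingleton_ext (p : ℕ) (hp : 2 ≤ p) : Subsingleton (Ext X Y p) := by
  have hS : (ShortComplex.mk _ (Projective.π X) (kernel.condition _)).ShortExact :=
    { exact := ShortComplex.exact_kernel _ }
  -- Right exactness of Ext¹(−, Z) makes a subobject of a projective projective, so `X` has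
  -- projective dimension at most 1.
  have : Projective (kernel (Projective.π X)) := projective_iff_subsingleton_ext_one.2 fun Z =>
    subsingleton_ext_one_iff.2 <| (extZ_of_subsingleton
      (Ext.subsingleton_of_projective (Projective.over X) Z 0)).of_shortExact hS
  have := hS.hasProjectiveDimensionLT_X₃ 1 inferInstance inferInstance
  exact HasProjectiveDimensionLT.subsingleton X 2 p hp Y

end QuiverRep

/-! ### Free representations and enough projectives -/

namespace QuiverRep

variable {k : Type u} [Field k] {Q : Type} [Quiver.{0} Q] {X Y Z : QuiverRep k Q}

/-- The linear map along a path. -/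
def pathLin (X : QuiverRep k Q) {i j : Q} (p : Quiver.Path i j) : X.sp i →ₗ[k] X.sp j :=
  (X.map (X := (Paths.of Q).obj i) (Y := (Paths.of Q).obj j) p).hom.hom

theorem pathLin_nil (i : Q) : X.pathLin (Quiver.Path.nil : Quiver.Path i i) = LinearMap.id :=
  congrArg (fun g => g.hom.hom) (X.map_id ((Paths.of Q).obj i))

theorem pathLin_cons {i j l : Q} (p : Quiver.Path i j) (α : j ⟶ l) :
    X.pathLin (p.cons α) = X.lin α ∘ₗ X.pathLin p :=
  congrArg (fun g => g.hom.hom) (X.map_comp (X := (Paths.of Q).obj i) (Y := (Paths.of Q).obj j)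
    (Z := (Paths.of Q).obj l) p ((Paths.of Q).map α))

open scoped DirectSum in
/-- Free representations exist if every vertex is the target of finitely many paths. -/
theorem exists_free [∀ j : Q, Finite (Σ i : Q, Quiver.Path i j)] (V : Q → FGModuleCat.{u} k) :
    ∃ (P : QuiverRep k Q) (ι : ∀ i, V i →ₗ[k] P.sp i),
      (∀ (Y : QuiverRep k Q) (h : ∀ i, V i →ₗ[k] Y.sp i),
        ∃ g : P ⟶ Y, ∀ i x, comp g i (ι i x) = h i x) ∧
      ∀ (Y : QuiverRep k Q) (g g' : P ⟶ Y),
        (∀ i x, comp g i (ι i x) = comp g' i (ι i x)) → g = g' := by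
  classical
  -- The space at `j` is the sum of one copy of `V i` for each path from `i` to `j`, and arrows act
  -- by extending paths.
  let W (j : Q) : Type u := ⨁ p : Σ i : Q, Quiver.Path i j, V p.1
  obtain ⟨P, e, he⟩ := exists_rep (fun j => FGModuleCat.of k (W j)) fun {j l} α =>
    DirectSum.toModule k _ (W l) fun p =>
      DirectSum.lof k (Σ i : Q, Quiver.Path i l) (fun p => V p.1) ⟨p.1, p.2.cons α⟩
  let γ {i j : Q} (p : Quiver.Path i j) : V i →ₗ[k] P.sp j := (e j).symm.toLinearMap ∘ₗ
    DirectSum.lof k (Σ i : Q, Quiver.Path i j) (fun p => V p.1) ⟨i, p⟩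
  have hγ : ∀ {i j l : Q} (p : Quiver.Path i j) (α : j ⟶ l) (x : V i),
      P.lin α (γ p x) = γ (p.cons α) x := fun {i j l} p α x => by
    apply (e l).injective
    rw [he]
    simp only [γ, LinearMap.comp_apply, LinearEquiv.coe_coe, LinearEquiv.apply_symm_apply]
    exact DirectSum.toModule_lof k _ _
  have hext : ∀ {M : Type u} [AddCommGroup M] [Module k M] (j : Q) (a b : P.sp j →ₗ[k] M),
      (∀ i (p : Quiver.Path i j) (x : V i), a (γ p x) = b (γ p x)) → ∀ x, a x = b x := by
    intro M _ _ j a b hab x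
    have : a ∘ₗ (e j).symm.toLinearMap = b ∘ₗ (e j).symm.toLinearMap :=
      DirectSum.linearMap_ext _ fun p => LinearMap.ext fun x => hab p.1 p.2 x
    obtain ⟨y, rfl⟩ := (e j).symm.surjective x
    exact LinearMap.congr_fun this y
  refine ⟨P, fun i => γ Quiver.Path.nil, fun Y h => ?_, fun Y g g' hg => hom_ext fun j => ?_⟩
  · let G (j : Q) : P.sp j →ₗ[k] Y.sp j :=
      DirectSum.toModule k _ (Y.sp j) (fun p : Σ i : Q, Quiver.Path i j => Y.pathLin p.2 ∘ₗ h p.1)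
        ∘ₗ (e j).toLinearMap
    have hG : ∀ {i j : Q} (p : Quiver.Path i j) (x : V i), G j (γ p x) = Y.pathLin p (h i x) :=
      fun {i j} p x => by
        simp only [G, γ, LinearMap.comp_apply, LinearEquiv.coe_coe, LinearEquiv.apply_symm_apply]
        exact DirectSum.toModule_lof k (M := fun p : Σ i : Q, Quiver.Path i j => V p.1) ⟨i, p⟩ x
    refine ⟨mkHom G fun {j l} α x => hext j (G l ∘ₗ P.lin α) (Y.lin α ∘ₗ G j)
      (fun i p x => ?_) x, fun i x => ?_⟩
    · simp only [LinearMap.comp_apply]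
      rw [hγ, hG, hG, pathLin_cons]
      rfl
    · rw [comp_mkHom, hG, pathLin_nil]
      rfl
  · refine hext j _ _ fun i p x => ?_
    induction p with
    | nil => exact hg i x
    | cons p α ih => rw [← hγ, comp_lin, comp_lin, ih]

/-- The free representation on the spaces of `X` covers `X`. It is projective since vertexwise lifts
of the generators extend to a morphism. -/
instance enoughProjectives [∀ j : Q, Finite (Σ i : Q, Quiver.Path i j)] :
    EnoughProjectives (QuiverRep k Q) where
  presentation X := by
    obtain ⟨P, ι, hι, hι'⟩ := exists_free (fun i => X.sp i)
    obtain ⟨g, hg⟩ := hι X fun i => LinearMap.id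
    have hepi : Epi g := epi_of_surjective g fun i x => ⟨ι i x, hg i x⟩
    suffices hP : Projective P from ⟨{ p := P, f := g }⟩
    refine ⟨fun {M N} f q _ => ?_⟩
    choose t ht using fun i => LinearMap.exists_rightInverse_apply (comp_surjective q i)
    obtain ⟨r, hr⟩ := hι M fun i => t i ∘ₗ comp f i ∘ₗ ι i
    refine ⟨r, hι' _ _ _ fun i x => ?_⟩
    rw [comp_comp, LinearMap.comp_apply, hr]
    exact ht i _

theorem finite_sigma_path {j : Q} [Finite (Σ i : Q, i ⟶ j)]
    (h : ∀ l : Q, (l ⟶ j) → Finite (Σ i : Q, Quiver.Path i l)) :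
    Finite (Σ i : Q, Quiver.Path i j) := by
  have := fun a : Σ l : Q, l ⟶ j => h a.1 a.2
  refine Finite.of_surjective (α := Option (Σ a : Σ l : Q, l ⟶ j, Σ i : Q, Quiver.Path i a.1))
    (fun a => a.elim ⟨j, Quiver.Path.nil⟩ fun a => ⟨a.2.1, a.2.2.cons a.1.2⟩) ?_
  rintro ⟨i, p⟩
  cases p with
  | nil => exact ⟨none, rfl⟩
  | cons p α => exact ⟨some ⟨⟨_, α⟩, ⟨_, p⟩⟩, rfl⟩

end QuiverRep

/-! ### Finiteness of the sets of paths in Q₁ and Q₂ -/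

theorem Q1.finite_arrows (j : Q1) : Finite (Σ i : Q1, i ⟶ j) := by
  cases j
  · exact Finite.of_injective (β := Empty) (fun a => nomatch a) fun a => nomatch a
  · exact Finite.of_surjective (fun _ : Unit => ⟨Q1.b, Q1.Arrow.bmid⟩) fun ⟨_, α⟩ => by
      change Q1.Arrow _ _ at α; cases α; exact ⟨(), rfl⟩
  · exact Finite.of_surjective (fun t : Bool => if t then ⟨Q1.b, Q1.Arrow.be⟩ else
      ⟨Q1.mid, Q1.Arrow.mide⟩) fun ⟨_, α⟩ => by
      change Q1.Arrow _ _ at α; cases α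
      exacts [⟨true, rfl⟩, ⟨false, rfl⟩]

instance Q1.finite_paths (j : Q1) : Finite (Σ i : Q1, Quiver.Path i j) := by
  have := Q1.finite_arrows
  have hb : Finite (Σ i : Q1, Quiver.Path i Q1.b) := QuiverRep.finite_sigma_path nofun
  have hm : Finite (Σ i : Q1, Quiver.Path i Q1.mid) := QuiverRep.finite_sigma_path fun l α => by
    change Q1.Arrow _ _ at α; cases α; exact hb
  cases j
  · exact hb
  · exact hm
  · refine QuiverRep.finite_sigma_path fun l α => ?_
    change Q1.Arrow _ _ at α; cases α
    exacts [hb, hm]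

theorem Q2.finite_arrows (j : Q2) : Finite (Σ i : Q2, i ⟶ j) := by
  cases j
  · exact Finite.of_injective (β := Empty) (fun a => nomatch a) fun a => nomatch a
  · exact Finite.of_surjective (fun _ : Unit => ⟨Q2.b, Q2.Arrow.bminus⟩) fun ⟨_, α⟩ => by
      change Q2.Arrow _ _ at α; cases α; exact ⟨(), rfl⟩
  · exact Finite.of_surjective (fun _ : Unit => ⟨Q2.b, Q2.Arrow.bplus⟩) fun ⟨_, α⟩ => by
      change Q2.Arrow _ _ at α; cases α; exact ⟨(), rfl⟩
  · exact Finite.of_surjective (fun t : Bool => if t then ⟨Q2.plus, Q2.Arrow.pluse⟩ else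
      ⟨Q2.minus, Q2.Arrow.minuse⟩) fun ⟨_, α⟩ => by
      change Q2.Arrow _ _ at α; cases α
      exacts [⟨true, rfl⟩, ⟨false, rfl⟩]

instance Q2.finite_paths (j : Q2) : Finite (Σ i : Q2, Quiver.Path i j) := by
  have := Q2.finite_arrows
  have hb : Finite (Σ i : Q2, Quiver.Path i Q2.b) := QuiverRep.finite_sigma_path nofun
  have hm : Finite (Σ i : Q2, Quiver.Path i Q2.minus) := QuiverRep.finite_sigma_path fun l α => by
    change Q2.Arrow _ _ at α; cases α; exact hb
  have hp : Finite (Σ i : Q2, Quiver.Path i Q2.plus) := QuiverRep.finite_sigma_path fun l α => by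
    change Q2.Arrow _ _ at α; cases α; exact hb
  cases j
  · exact hb
  · exact hm
  · exact hp
  · refine QuiverRep.finite_sigma_path fun l α => ?_
    change Q2.Arrow _ _ at α; cases α
    exacts [hp, hm]

/-! ### Transfer from the square quiver to Q₁ and Q₂ -/

namespace QuiverRep

open Abelian

variable {k : Type u} [Field k] {Q : Type} [Quiver.{0} Q]

/-- `Φ` identifies representations of `Q` with certain representations of the square quiver,
compatibly with `Hom` and with the vanishing of `Ext¹`. -/
structure SqModel (Φ : QuiverRep k Q → SqRep k) where
  map (X Y : QuiverRep k Q) : (X ⟶ Y) → SqRep.C0 (Φ X) (Φ Y)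
  map_smul_id (X : QuiverRep k Q) (c : k) : map X X (c • 𝟙 X) = c • SqRep.one (Φ X)
  map_injective (X Y : QuiverRep k Q) : Function.Injective (map X Y)
  map_zero (X Y : QuiverRep k Q) : map X Y 0 = 0
  isHom_iff (X Y : QuiverRep k Q) (f : SqRep.C0 (Φ X) (Φ Y)) : SqRep.IsHom f ↔ ∃ g, map X Y g = f
  extZ_iff (X Y : QuiverRep k Q) : ExtZ X Y ↔ SqRep.ExtZ (Φ X) (Φ Y)

namespace SqModel

variable {Φ : QuiverRep k Q → SqRep k} (h : SqModel Φ) {X Y : QuiverRep k Q}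

include h

theorem homZ_iff : SqRep.HomZ (Φ X) (Φ Y) ↔ Subsingleton (X ⟶ Y) := by
  constructor
  · intro hz
    refine subsingleton_of_forall_eq 0 fun g => h.map_injective X Y ?_
    rw [h.map_zero]
    exact hz _ ((h.isHom_iff X Y _).2 ⟨g, rfl⟩)
  · intro hs f hf
    obtain ⟨g, rfl⟩ := (h.isHom_iff X Y f).1 hf
    rw [Subsingleton.elim g 0, h.map_zero]

theorem nontrivial_hom_iff : Nontrivial (X ⟶ Y) ↔ ¬ SqRep.HomZ (Φ X) (Φ Y) := by
  rw [h.homZ_iff, not_subsingleton_iff_nontrivial]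

variable [∀ j : Q, Finite (Σ i : Q, Quiver.Path i j)]

theorem subsingleton_ext_one_iff : Subsingleton (Ext X Y 1) ↔ SqRep.ExtZ (Φ X) (Φ Y) :=
  QuiverRep.subsingleton_ext_one_iff.trans (h.extZ_iff X Y)

theorem nontrivial_ext_one_iff : Nontrivial (Ext X Y 1) ↔ ¬ SqRep.ExtZ (Φ X) (Φ Y) := by
  rw [← h.subsingleton_ext_one_iff, not_subsingleton_iff_nontrivial]

theorem homStarVanishes_iff : HomStarVanishes X Y ↔
    SqRep.HomZ (Φ X) (Φ Y) ∧ SqRep.ExtZ (Φ X) (Φ Y) := by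
  rw [h.homZ_iff, ← h.subsingleton_ext_one_iff]
  constructor
  · intro hv
    exact ⟨Ext.homEquiv₀.subsingleton_congr.1 (hv 0), hv 1⟩
  · rintro ⟨h0, h1⟩ (_ | _ | p)
    · exact Ext.homEquiv₀.subsingleton_congr.2 h0
    · exact h1
    · exact subsingleton_ext _ (by omega)

theorem exc (hX : IsExceptional k X) : SqRep.Exc (Φ X) := by
  obtain ⟨e, he, -⟩ := finrank_eq_one_iff'.1 hX.finrank_end
  have hid : (𝟙 X : X ⟶ X) ≠ 0 := fun h0 => he <| by rw [← Category.comp_id e, h0, Limits.comp_zero]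
  refine ⟨fun h0 => hid (h.map_injective X X ?_), fun f hf => ?_,
    h.subsingleton_ext_one_iff.1 (hX.ext_self 1 le_rfl)⟩
  · rw [h.map_zero, ← one_smul k (𝟙 X), h.map_smul_id, h0, smul_zero]
  · obtain ⟨g, rfl⟩ := (h.isHom_iff X X f).1 hf
    obtain ⟨c, hc⟩ := (finrank_eq_one_iff_of_nonzero' (𝟙 X) hid).1 hX.finrank_end g
    exact ⟨c, by rw [← hc, h.map_smul_id]⟩

variable [IsAlgClosed k]

theorem rpProperty1 : RPProperty1 (QuiverRep k Q) k := fun _ _ hΓ _ _ hΓX =>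
  h.homStarVanishes_iff.2 <| (h.exc hΓ.left).homZ_extZ_of_couple (h.exc hΓ.right)
    (h.nontrivial_ext_one_iff.1 hΓ.ext_left_right) (h.nontrivial_ext_one_iff.1 hΓ.ext_right_left)
    (h.homStarVanishes_iff.1 hΓX).1 (h.homStarVanishes_iff.1 hΓX).2

theorem rpProperty2 : RPProperty2 (QuiverRep k Q) k := fun _ _ hΓ _ _ hX hY hΓX hXY hΓY =>
  h.nontrivial_hom_iff.2 <| (h.exc hΓ.left).not_homZ_of_couple (h.exc hΓ.right)
    (h.nontrivial_ext_one_iff.1 hΓ.ext_left_right) (h.nontrivial_ext_one_iff.1 hΓ.ext_right_left)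
    (h.exc hX) (h.exc hY) (h.nontrivial_hom_iff.1 hΓX) (h.nontrivial_hom_iff.1 hXY)
    (h.homStarVanishes_iff.1 hΓY).1 (h.homStarVanishes_iff.1 hΓY).2

theorem atMostOneNonzeroDegree (hX : IsExceptional k X) (hY : IsExceptional k Y) :
    AtMostOneNonzeroDegree X Y := by
  have h2 : ∀ p, ¬ Nontrivial (Ext X Y (p + 2)) := fun p =>
    not_nontrivial_iff_subsingleton.2 (subsingleton_ext _ (by omega))
  have h01 : ¬ (Nontrivial (Ext X Y 0) ∧ Nontrivial (Ext X Y 1)) := fun ⟨h0, h1⟩ =>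
    ((h.exc hX).homZ_or_extZ (h.exc hY)).elim
      (h.nontrivial_hom_iff.1 (Ext.homEquiv₀.nontrivial_congr.1 h0))
      (h.nontrivial_ext_one_iff.1 h1)
  rintro (_ | _ | p) (_ | _ | q) hp hq
  · rfl
  · exact absurd ⟨hp, hq⟩ h01
  · exact absurd hq (h2 _)
  · exact absurd ⟨hq, hp⟩ h01
  · rfl
  · exact absurd hq (h2 _)
  all_goals exact absurd hp (h2 _)

end SqModel

/-- A representation of `Q₁` as a representation of the square quiver with an identity arrow. -/
def sqOfQ1 (X : QuiverRep k Q1) : SqRep k where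
  b := X.sp Q1.b
  s σ := X.sp (match σ with | true => Q1.mid | false => Q1.b)
  e := X.sp Q1.e
  i σ := match σ with
    | true => X.lin Q1.Arrow.bmid
    | false => LinearMap.id
  o σ := match σ with
    | true => X.lin Q1.Arrow.mide
    | false => X.lin Q1.Arrow.be

/-- A representation of `Q₂` as a representation of the square quiver. -/
def sqOfQ2 (X : QuiverRep k Q2) : SqRep k where
  b := X.sp Q2.b
  s σ := X.sp (match σ with | true => Q2.plus | false => Q2.minus)
  e := X.sp Q2.e
  i σ := match σ with
    | true => X.lin Q2.Arrow.bplus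
    | false => X.lin Q2.Arrow.bminus
  o σ := match σ with
    | true => X.lin Q2.Arrow.pluse
    | false => X.lin Q2.Arrow.minuse

theorem sqModelQ1 : Nonempty (SqModel (sqOfQ1 (k := k))) := by
  refine ⟨⟨fun X Y f => (comp f Q1.b, fun σ => comp f _, comp f Q1.e), fun X c => rfl,
    fun X Y f g hfg => hom_ext fun i x => ?_, fun X Y => rfl, fun X Y f => ⟨fun hf => ?_, ?_⟩,
    fun X Y => ?_⟩⟩
  · have hs := congrArg Prod.snd hfg
    cases i
    exacts [LinearMap.congr_fun (congrArg Prod.fst hfg) x,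
      LinearMap.congr_fun (congrFun (congrArg Prod.fst hs) true) x,
      LinearMap.congr_fun (congrArg Prod.snd hs) x]
  · have hb : f.2.1 false = f.1 := LinearMap.ext (hf.i false)
    refine ⟨mkHom (fun i => match i with
      | Q1.b => f.1
      | Q1.mid => f.2.1 true
      | Q1.e => f.2.2) fun α x => ?_, Prod.ext rfl (Prod.ext (funext fun σ => ?_) rfl)⟩
    · change Q1.Arrow _ _ at α
      cases α
      · exact (hf.o false x).trans (congrArg _ (LinearMap.congr_fun hb x))
      · exact hf.i true x
      · exact hf.o true x
    · cases σ
      exacts [hb.symm, rfl]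
  · rintro ⟨g, rfl⟩
    exact ⟨fun σ x => by cases σ; exacts [rfl, comp_lin g _ x],
      fun σ x => by cases σ; exacts [comp_lin g _ x, comp_lin g _ x]⟩
  · rw [SqRep.extZ_iff]
    constructor
    · intro h φ
      let φb : X.sp Q1.b →ₗ[k] Y.sp Q1.b := φ.1 false
      let φe : X.sp Q1.b →ₗ[k] Y.sp Q1.e := φ.2 false
      -- The cochain `φb` on the identity arrow is absorbed by using `g Q1.b + φb` at s false. This
      -- changes the equation on the arrow to e by `Y.lin Q1.Arrow.be ∘ₗ φb`, which is added in
      -- advance.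
      obtain ⟨g, hg⟩ := h fun {i j} α => match i, j, α with
        | _, _, Q1.Arrow.be => φe + Y.lin Q1.Arrow.be ∘ₗ φb
        | _, _, Q1.Arrow.bmid => φ.1 true
        | _, _, Q1.Arrow.mide => φ.2 true
      refine ⟨(g Q1.b, fun σ => match σ with
        | true => g Q1.mid
        | false => g Q1.b + φb, g Q1.e), fun σ x => ?_, fun σ x => ?_⟩
      · cases σ
        · exact add_sub_cancel_left (g Q1.b x) (φb x)
        · exact hg Q1.Arrow.bmid x
      · cases σ
        · have h1 : g Q1.e (X.lin Q1.Arrow.be x) - Y.lin Q1.Arrow.be (g Q1.b x) =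
            φe x + Y.lin Q1.Arrow.be (φb x) := hg Q1.Arrow.be x
          change g Q1.e (X.lin Q1.Arrow.be x) - Y.lin Q1.Arrow.be (g Q1.b x + φb x) = φe x
          rw [map_add, ← sub_sub, h1, add_sub_cancel_right]
        · exact hg Q1.Arrow.mide x
    · intro h φ
      obtain ⟨g, hg1, hg2⟩ := h (fun σ => match σ with
        | true => φ Q1.Arrow.bmid
        | false => 0, fun σ => match σ with
        | true => φ Q1.Arrow.mide
        | false => φ Q1.Arrow.be)
      have hb : g.2.1 false = g.1 := LinearMap.ext fun x => sub_eq_zero.1 (hg1 false x)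
      refine ⟨fun i => match i with
        | Q1.b => g.1
        | Q1.mid => g.2.1 true
        | Q1.e => g.2.2, fun α x => ?_⟩
      change Q1.Arrow _ _ at α
      cases α
      · have := hg2 false x
        rw [hb] at this
        exact this
      · exact hg1 true x
      · exact hg2 true x

theorem sqModelQ2 : Nonempty (SqModel (sqOfQ2 (k := k))) := by
  refine ⟨⟨fun X Y f => (comp f Q2.b, fun σ => comp f _, comp f Q2.e), fun X c => rfl,
    fun X Y f g hfg => hom_ext fun i x => ?_, fun X Y => rfl, fun X Y f => ⟨fun hf => ?_, ?_⟩,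
    fun X Y => ?_⟩⟩
  · have hs := congrArg Prod.snd hfg
    cases i
    exacts [LinearMap.congr_fun (congrArg Prod.fst hfg) x,
      LinearMap.congr_fun (congrFun (congrArg Prod.fst hs) false) x,
      LinearMap.congr_fun (congrFun (congrArg Prod.fst hs) true) x,
      LinearMap.congr_fun (congrArg Prod.snd hs) x]
  · refine ⟨mkHom (fun i => match i with
      | Q2.b => f.1
      | Q2.plus => f.2.1 true
      | Q2.minus => f.2.1 false
      | Q2.e => f.2.2) fun α x => ?_, Prod.ext rfl (Prod.ext (funext fun σ => ?_) rfl)⟩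
    · change Q2.Arrow _ _ at α
      cases α
      exacts [hf.i true x, hf.i false x, hf.o true x, hf.o false x]
    · cases σ <;> rfl
  · rintro ⟨g, rfl⟩
    exact ⟨fun σ x => by cases σ <;> exact comp_lin g _ x,
      fun σ x => by cases σ <;> exact comp_lin g _ x⟩
  · rw [SqRep.extZ_iff]
    constructor
    · intro h φ
      obtain ⟨g, hg⟩ := h fun {i j} α => match i, j, α with
        | _, _, Q2.Arrow.bplus => φ.1 true
        | _, _, Q2.Arrow.bminus => φ.1 false
        | _, _, Q2.Arrow.pluse => φ.2 true
        | _, _, Q2.Arrow.minuse => φ.2 false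
      refine ⟨(g Q2.b, fun σ => g _, g Q2.e), fun σ x => ?_, fun σ x => ?_⟩
      · cases σ
        exacts [hg Q2.Arrow.bminus x, hg Q2.Arrow.bplus x]
      · cases σ
        exacts [hg Q2.Arrow.minuse x, hg Q2.Arrow.pluse x]
    · intro h φ
      obtain ⟨g, hg1, hg2⟩ := h (fun σ => match σ with
        | true => φ Q2.Arrow.bplus
        | false => φ Q2.Arrow.bminus, fun σ => match σ with
        | true => φ Q2.Arrow.pluse
        | false => φ Q2.Arrow.minuse)
      refine ⟨fun i => match i with
        | Q2.b => g.1
        | Q2.plus => g.2.1 true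
        | Q2.minus => g.2.1 false
        | Q2.e => g.2.2, fun α x => ?_⟩
      change Q2.Arrow _ _ at α
      cases α
      exacts [hg1 true x, hg1 false x, hg2 true x, hg2 false x]

end QuiverRep

theorem mainTheorem3 (k : Type u) [Field k] [IsAlgClosed k] :
    (RPProperty1 (QuiverRep k Q1) k ∧ RPProperty2 (QuiverRep k Q1) k) ∧
    (RPProperty1 (QuiverRep k Q2) k ∧ RPProperty2 (QuiverRep k Q2) k) ∧
    (∀ X Y : QuiverRep k Q1, IsExceptional k X → IsExceptional k Y →
      AtMostOneNonzeroDegree X Y) ∧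
    (∀ X Y : QuiverRep k Q2, IsExceptional k X → IsExceptional k Y →
      AtMostOneNonzeroDegree X Y) := by
  obtain ⟨h1⟩ := QuiverRep.sqModelQ1 (k := k)
  obtain ⟨h2⟩ := QuiverRep.sqModelQ2 (k := k)
  exact ⟨⟨h1.rpProperty1, h1.rpProperty2⟩, ⟨h2.rpProperty1, h2.rpProperty2⟩,
    fun _ _ => h1.atMostOneNonzeroDegree, fun _ _ => h2.atMostOneNonzeroDegree⟩
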